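/- Let $q\ge 2$ be an integer, let $\lambda\in[-\frac1{q-1},1]$, and let $P_\lambda(j|i)=\lambda\mathbf 1\{i=j\}+\frac{1-\lambda}{q}$ for $i,j\in[q]$. Let $T$ be either the regular tree in which every vertex has $d$ children ($d\ge 0$ an integer), or the Galton–Watson tree with offspring distribution $\mathrm{Pois}(d)$ ($d\ge 0$ real), with root $\rho$. Given $T$, let $\sigma_\rho$ be uniform on $[q]$ and, given $\sigma_u$, let the colours of the children of $u$ be i.i.d. with law $P_\lambda(\cdot|\sigma_u)$. Let $L_k$ (resp. $T_k$) be the set of vertices at distance exactly (resp. at most) $k$ from $\rho$; in a conditioning, $T_k$ stands for the tree up to depth $k$. Let $I$ denote (conditional) mutual information. A channel (Markov kernel) $W$ from $[q]$ to a measurable space $\mathcal Y$ is *fully memoryless symmetric* (FMS) if there is a homomorphism $\iota$ from the symmetric group of $[q]$ to the group of measurable automorphisms of $\mathcal Y$ such that $W(E|x)=W(\iota(\tau)E\,|\,\tau(x))$ for all measurable $E\subseteq\mathcal Y$, all $x\in[q]$ and all permutations $\tau$ of $[q]$. Its $\chi^2$-capacity is $C_{\chi^2}(W)=\mathbb E\big[q\sum_{i\in[q]}\pi_i^2-1\big]$,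 where $\pi$ is the posterior distribution of the input given the output when the input is uniform on $[q]$. Given $(T,\sigma)$, let $\omega_v\sim W(\cdot|\sigma_v)$ independently for all vertices $v$ (the survey). **Theorem.** Suppose that $d\lambda^2<1$ and that reconstruction is possible, i.e. $\lim_{k\to\infty} I(\sigma_\rho;\sigma_{L_k}\,|\,T_k)>0$. Then there is $\epsilon>0$ such that for every FMS channel $W$ with $C_{\chi^2}(W)\le\epsilon$ the following limit exists and satisfies $$\lim_{k\to\infty} I(\sigma_\rho;\sigma_{L_k}\,|\,T_k,\omega_{T_k})>0 .$$ -/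

import Mathlib

open MeasureTheory ProbabilityTheory InformationTheory Filter Topology
open scoped NNReal ENNReal

universe u v w

noncomputable section

/-! ### Trees of bounded depth with labelled vertices -/

/-- The subtrees below the root: a number `b` and a `b`-tuple. -/
abbrev Branches (β : Type u) : Type u := Σ b : ℕ, Fin b → β

/-- The branches given by a `b`-tuple. -/
def Branches.mk {β : Type u} (b : ℕ) (f : Fin b → β) : Branches β := ⟨b, f⟩

theorem Branches.measurable_mk {β : Type u} [MeasurableSpace β] (b : ℕ) :
    Measurable (Branches.mk b : (Fin b → β) → Branches β) :=
  measurable_iff_le_map.2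
    (iInf_le (fun a : ℕ => MeasurableSpace.map (Sigma.mk a) inferInstance) b)

/-- Rooted (plane) trees of depth at most `k` with every vertex labelled by an element of `α`:
the label of the root, the number `b` of children of the root, and the `b` subtrees below it.
The vertices at distance `k` from the root carry a label only (their children are not recorded). -/
def LTree (α : Type u) : ℕ → Type u
  | 0 => α
  | k + 1 => α × Branches (LTree α k)

/-- Labellings of the vertices at distance exactly `k` from the root of a tree. -/
def LeafLabels (α : Type u) : ℕ → Type u
  | 0 => α
  | k + 1 => Branches (LeafLabels α k)

instance LTree.instMeasurableSpace {α : Type u} [MeasurableSpace α] :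
    (k : ℕ) → MeasurableSpace (LTree α k)
  | 0 => inferInstanceAs (MeasurableSpace α)
  | k + 1 =>
    letI := LTree.instMeasurableSpace (α := α) k
    inferInstanceAs (MeasurableSpace (α × Branches (LTree α k)))

instance LeafLabels.instMeasurableSpace {α : Type u} [MeasurableSpace α] :
    (k : ℕ) → MeasurableSpace (LeafLabels α k)
  | 0 => inferInstanceAs (MeasurableSpace α)
  | k + 1 =>
    letI := LeafLabels.instMeasurableSpace (α := α) k
    inferInstanceAs (MeasurableSpace (Branches (LeafLabels α k)))

/-- The label of the root. -/
def LTree.root {α : Type u} : {k : ℕ} → LTree α k → α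
  | 0, a => a
  | _ + 1, t => t.1

/-- The labels of the vertices at distance `k` from the root. -/
def LTree.leaves {α : Type u} : {k : ℕ} → LTree α k → LeafLabels α k
  | 0, a => a
  | _ + 1, t => ⟨t.2.1, fun j => (t.2.2 j).leaves⟩

/-- The underlying tree, all labels being forgotten. -/
def LTree.shape {α : Type u} : {k : ℕ} → LTree α k → LTree Unit k
  | 0, _ => ()
  | _ + 1, t => ((), ⟨t.2.1, fun j => (t.2.2 j).shape⟩)

theorem sigma_discreteMeasurableSpace {ι : Type u} {β : ι → Type v}
    [∀ i, MeasurableSpace (β i)] [∀ i, DiscreteMeasurableSpace (β i)] :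
    DiscreteMeasurableSpace (Sigma β) :=
  ⟨fun s => by
    refine MeasurableSpace.measurableSet_iInf.2 fun i => ?_
    exact MeasurableSet.of_discrete (s := Sigma.mk i ⁻¹' s)⟩

instance LTree.instCountable {α : Type u} [Countable α] : (k : ℕ) → Countable (LTree α k)
  | 0 => inferInstanceAs (Countable α)
  | k + 1 =>
    haveI := LTree.instCountable (α := α) k
    inferInstanceAs (Countable (α × Branches (LTree α k)))

instance LeafLabels.instCountable {α : Type u} [Countable α] :
    (k : ℕ) → Countable (LeafLabels α k)
  | 0 => inferInstanceAs (Countable α)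
  | k + 1 =>
    haveI := LeafLabels.instCountable (α := α) k
    inferInstanceAs (Countable (Branches (LeafLabels α k)))

instance LTree.instDiscrete {α : Type u} [Countable α] [MeasurableSpace α]
    [DiscreteMeasurableSpace α] : (k : ℕ) → DiscreteMeasurableSpace (LTree α k)
  | 0 => inferInstanceAs (DiscreteMeasurableSpace α)
  | k + 1 =>
    haveI := LTree.instDiscrete (α := α) k
    haveI : DiscreteMeasurableSpace (Branches (LTree α k)) := sigma_discreteMeasurableSpace
    inferInstanceAs (DiscreteMeasurableSpace (α × Branches (LTree α k)))

instance LeafLabels.instDiscrete {α : Type u} [Countable α] [MeasurableSpace α]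
    [DiscreteMeasurableSpace α] : (k : ℕ) → DiscreteMeasurableSpace (LeafLabels α k)
  | 0 => inferInstanceAs (DiscreteMeasurableSpace α)
  | k + 1 =>
    haveI := LeafLabels.instDiscrete (α := α) k
    (sigma_discreteMeasurableSpace :
      DiscreteMeasurableSpace (Branches (LeafLabels α k)))

instance LeafLabels.instNonempty {α : Type u} [Nonempty α] :
    (k : ℕ) → Nonempty (LeafLabels α k)
  | 0 => inferInstanceAs (Nonempty α)
  | k + 1 => ⟨(⟨0, Fin.elim0⟩ : Branches (LeafLabels α k))⟩

/-! ### The Potts model on a regular or Poisson tree -/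

/-- The two kinds of trees: the regular tree in which every vertex has exactly `d` children, and
the Galton-Watson tree with Poisson offspring distribution of mean `d`. -/
inductive TreeKind : Type
  | regular (d : ℕ)
  | poisson (d : ℝ≥0)

/-- The (expected) number of children of a vertex. -/
def TreeKind.degree : TreeKind → ℝ
  | .regular d => d
  | .poisson d => d

/-- The law of the number of children of a vertex. -/
def TreeKind.offspring : TreeKind → Measure ℕ
  | .regular d => Measure.dirac d
  | .poisson d => poissonMeasure d

instance TreeKind.instIsProbabilityMeasure (t : TreeKind) : IsProbabilityMeasure t.offspring := by
  cases t <;> (unfold TreeKind.offspring; infer_instance)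

/-- The admissible range `[-1/(q-1), 1]` of the edge correlation strength. -/
abbrev PottsRange (q : ℕ) : Set ℝ := Set.Icc (-(1 / ((q : ℝ) - 1))) 1

/-- The Potts channel `P_lam(j | i) = lam * 1{i = j} + (1 - lam) / q`. -/
def pottsChannel (q : ℕ) (lam : PottsRange q) : Kernel (Fin q) (Fin q) :=
  Kernel.ofFunOfCountable fun i =>
    ∑ j : Fin q,
      ENNReal.ofReal ((lam : ℝ) * (if i = j then 1 else 0) + (1 - (lam : ℝ)) / q) •
        Measure.dirac j

theorem potts_weight_nonneg (q : ℕ) (lam : PottsRange q) (i j : Fin q) :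
    0 ≤ (lam : ℝ) * (if i = j then 1 else 0) + (1 - (lam : ℝ)) / q := by
  obtain ⟨l, hl1, hl2⟩ := lam
  have hq : (1 : ℝ) ≤ q := by exact_mod_cast Nat.one_le_of_lt i.isLt
  have hq0 : (0 : ℝ) < q := by linarith
  have h2 : 0 ≤ (1 - l) / q := div_nonneg (by linarith) hq0.le
  simp only
  split_ifs with h
  · rcases hq.eq_or_lt with h1 | h1
    · rw [← h1]; linarith
    · have hq1 : (0 : ℝ) < (q : ℝ) - 1 := by linarith
      have h3 : -1 ≤ l * ((q : ℝ) - 1) := by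
        have := mul_le_mul_of_nonneg_right hl1 hq1.le
        rwa [neg_mul, one_div, inv_mul_cancel₀ hq1.ne'] at this
      have h4 : l * 1 + (1 - l) / q = (l * ((q : ℝ) - 1) + 1) / q := by
        field_simp; ring
      rw [h4]
      exact div_nonneg (by linarith) hq0.le
  · linarith

instance pottsChannel.instIsMarkovKernel (q : ℕ) (lam : PottsRange q) :
    IsMarkovKernel (pottsChannel q lam) :=
  ⟨fun i => ⟨by
    have hq : (q : ℝ) ≠ 0 := by
      have : 0 < q := Nat.zero_lt_of_lt i.isLt
      positivity
    change (∑ j : Fin q, ENNReal.ofReal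
      ((lam : ℝ) * (if i = j then 1 else 0) + (1 - (lam : ℝ)) / q) • Measure.dirac j) Set.univ = 1
    simp only [Measure.coe_finsetSum, Finset.sum_apply, Measure.smul_apply, measure_univ,
      smul_eq_mul, mul_one]
    rw [← ENNReal.ofReal_sum_of_nonneg fun j _ => potts_weight_nonneg q lam i j,
      Finset.sum_add_distrib, ← Finset.mul_sum]
    simp
    field_simp
    ring⟩⟩

/-- The law of `(T_k, σ_{T_k})` given the colour of the root: the root has a random number `b` of
children, the colours of the children are drawn independently from the Potts channel applied to
the colour of the root, and the trees below the children are then independent, each distributed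
as the model of depth one less. -/
def pottsTree (q : ℕ) (lam : PottsRange q) (t : TreeKind) :
    (k : ℕ) → Kernel (Fin q) (LTree (Fin q) k)
  | 0 => (Kernel.id : Kernel (Fin q) (Fin q))
  | k + 1 => (Kernel.ofFunOfCountable fun i =>
      (Measure.dirac i).prod
        (t.offspring.bind fun b =>
          (Measure.pi fun _ : Fin b =>
            (pottsChannel q lam i).bind (pottsTree q lam t k)).map (Branches.mk b)) :
      Kernel (Fin q) (Fin q × Branches (LTree (Fin q) k)))

theorem isProbabilityMeasure_bind_sigma {β : Type u} [MeasurableSpace β] (D : Measure ℕ)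
    [IsProbabilityMeasure D] (m : (b : ℕ) → Measure (Fin b → β))
    [∀ b, IsProbabilityMeasure (m b)] :
    IsProbabilityMeasure
      (D.bind fun b => (m b).map (Branches.mk b)) := by
  refine isProbabilityMeasure_bind (measurable_of_countable _).aemeasurable
    (ae_of_all _ fun b => ?_)
  exact Measure.isProbabilityMeasure_map (Branches.measurable_mk b).aemeasurable

instance pottsTree.instIsMarkovKernel (q : ℕ) (lam : PottsRange q) (t : TreeKind) :
    (k : ℕ) → IsMarkovKernel (pottsTree q lam t k)
  | 0 => inferInstanceAs (IsMarkovKernel (Kernel.id : Kernel (Fin q) (Fin q)))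
  | k + 1 => ⟨fun i => by
      have := pottsTree.instIsMarkovKernel q lam t k
      have : IsProbabilityMeasure ((pottsChannel q lam i).bind (pottsTree q lam t k)) :=
        isProbabilityMeasure_bind (Kernel.measurable _).aemeasurable
          (ae_of_all _ fun _ => inferInstance)
      have := isProbabilityMeasure_bind_sigma t.offspring fun b =>
        Measure.pi fun _ : Fin b => (pottsChannel q lam i).bind (pottsTree q lam t k)
      exact inferInstanceAs (IsProbabilityMeasure ((Measure.dirac i).prod
        (t.offspring.bind fun b =>
          (Measure.pi fun _ : Fin b =>
            (pottsChannel q lam i).bind (pottsTree q lam t k)).map (Branches.mk b))))⟩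

/-- The uniform distribution on the set of colours. -/
def uniformColour (q : ℕ) [NeZero q] : Measure (Fin q) :=
  (PMF.uniformOfFintype (Fin q)).toMeasure

instance uniformColour.instIsProbabilityMeasure (q : ℕ) [NeZero q] :
    IsProbabilityMeasure (uniformColour q) := by
  unfold uniformColour; infer_instance

/-- The law of `(T_k, σ_{T_k})` in the Potts model: the root has a uniform colour. -/
def pottsLaw (q : ℕ) [NeZero q] (lam : PottsRange q) (t : TreeKind) (k : ℕ) :
    Measure (LTree (Fin q) k) :=
  (uniformColour q).bind (pottsTree q lam t k)

instance pottsLaw.instIsProbabilityMeasure (q : ℕ) [NeZero q] (lam : PottsRange q)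
    (t : TreeKind) (k : ℕ) : IsProbabilityMeasure (pottsLaw q lam t k) :=
  isProbabilityMeasure_bind (Kernel.measurable _).aemeasurable (ae_of_all _ fun _ => inferInstance)

/-! ### Survey -/

/-- The law of `ω_{T_k}` given `(T_k, σ_{T_k})`: the colour of every vertex is observed
independently through the channel `W`. -/
def survey {q : ℕ} {Y : Type u} [MeasurableSpace Y] (W : Kernel (Fin q) Y) :
    {k : ℕ} → LTree (Fin q) k → Measure (LTree Y k)
  | 0, c => W c
  | _ + 1, s => (W s.1).prod ((Measure.pi fun j => survey W (s.2.2 j)).map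
      (Branches.mk s.2.1))

/-- The survey as a channel from coloured trees to observations. -/
def surveyKernel {q : ℕ} {Y : Type u} [MeasurableSpace Y] (W : Kernel (Fin q) Y) (k : ℕ) :
    Kernel (LTree (Fin q) k) (LTree Y k) :=
  Kernel.ofFunOfCountable fun s => survey W s

theorem isProbabilityMeasure_survey {q : ℕ} {Y : Type u} [MeasurableSpace Y]
    (W : Kernel (Fin q) Y) [IsMarkovKernel W] :
    (k : ℕ) → (s : LTree (Fin q) k) → IsProbabilityMeasure (survey W s)
  | 0, c => by
      have h : ∀ i : Fin q, IsProbabilityMeasure (W i) := fun i => inferInstance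
      exact h c
  | k + 1, s => by
      have : ∀ j, IsProbabilityMeasure (survey W (s.2.2 j)) := fun j =>
        isProbabilityMeasure_survey W k (s.2.2 j)
      have := Measure.isProbabilityMeasure_map (μ := Measure.pi fun j => survey W (s.2.2 j))
        (Branches.measurable_mk s.2.1).aemeasurable
      exact inferInstanceAs (IsProbabilityMeasure ((W s.1).prod
        ((Measure.pi fun j => survey W (s.2.2 j)).map
          (Branches.mk s.2.1))))

instance surveyKernel.instIsMarkovKernel {q : ℕ} {Y : Type u} [MeasurableSpace Y]
    (W : Kernel (Fin q) Y) [IsMarkovKernel W] (k : ℕ) : IsMarkovKernel (surveyKernel W k) :=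
  ⟨fun s => isProbabilityMeasure_survey W k s⟩

/-- The joint law of `((T_k, σ_{T_k}), ω_{T_k})`. -/
def surveyLaw (q : ℕ) [NeZero q] (lam : PottsRange q) (t : TreeKind) {Y : Type u}
    [MeasurableSpace Y] (W : Kernel (Fin q) Y) (k : ℕ) :
    Measure (LTree (Fin q) k × LTree Y k) :=
  pottsLaw q lam t k ⊗ₘ surveyKernel W k

instance surveyLaw.instIsProbabilityMeasure (q : ℕ) [NeZero q] (lam : PottsRange q)
    (t : TreeKind) {Y : Type u} [MeasurableSpace Y] (W : Kernel (Fin q) Y) [IsMarkovKernel W]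
    (k : ℕ) : IsProbabilityMeasure (surveyLaw q lam t W k) := by
  unfold surveyLaw; infer_instance

/-! ### Information measures -/

/-- The conditional mutual information `I(A; B | C) = D(P_{CAB} ‖ P_C P_{A|C} P_{B|C})`
(in nats). -/
def condMutualInfo {Ω : Type u} {α : Type v} {β : Type w} {γ : Type*} [MeasurableSpace Ω]
    [MeasurableSpace α] [StandardBorelSpace α] [Nonempty α]
    [MeasurableSpace β] [StandardBorelSpace β] [Nonempty β] [MeasurableSpace γ]
    (P : Measure Ω) [IsFiniteMeasure P] (A : Ω → α) (B : Ω → β) (C : Ω → γ) : ℝ≥0∞ :=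
  klDiv (P.map fun x => (C x, A x, B x))
    ((P.map C) ⊗ₘ (condDistrib A C P ×ₖ condDistrib B C P))

/-- `I(σ_ρ; σ_{L_k} | T_k)`. -/
def leafInfo (q : ℕ) [NeZero q] (lam : PottsRange q) (t : TreeKind) (k : ℕ) : ℝ≥0∞ :=
  condMutualInfo (pottsLaw q lam t k) LTree.root LTree.leaves LTree.shape

/-- `I(σ_ρ; σ_{L_k} | T_k, ω_{T_k})`. -/
def leafInfoGivenSurvey (q : ℕ) [NeZero q] (lam : PottsRange q) (t : TreeKind) {Y : Type u}
    [MeasurableSpace Y] (W : Kernel (Fin q) Y) [IsMarkovKernel W] (k : ℕ) : ℝ≥0∞ :=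
  condMutualInfo (surveyLaw q lam t W k) (fun x => x.1.root) (fun x => x.1.leaves)
    (fun x => (x.1.shape, x.2))

/-- The model admits reconstruction: `lim_k I(σ_ρ; σ_{L_k} | T_k) > 0`. -/
def AdmitsReconstruction (q : ℕ) [NeZero q] (lam : PottsRange q) (t : TreeKind) : Prop :=
  ∃ l : ℝ≥0∞, 0 < l ∧ Tendsto (leafInfo q lam t) atTop (𝓝 l)

/-! ### Fully memoryless symmetric channels -/

/-- A channel with input alphabet `Fin q` is fully memoryless symmetric if the symmetric group of
the input alphabet acts on the output space by measurable bijections so that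
`W(E | x) = W(τ E | τ x)`. -/
def IsFMS {q : ℕ} {Y : Type u} [MeasurableSpace Y] (W : Kernel (Fin q) Y) : Prop :=
  ∃ ι : Equiv.Perm (Fin q) →* Equiv.Perm Y,
    (∀ τ, Measurable (ι τ)) ∧
      ∀ (τ : Equiv.Perm (Fin q)) (x : Fin q) (E : Set Y), MeasurableSet E →
        W x E = W (τ x) (ι τ '' E)

/-- The `χ²`-capacity `E[q ∑_i π_i² - 1]`, where `π` is the posterior distribution of the input
given the output, the input being uniform. -/
def chiSqCapacity {q : ℕ} [NeZero q] {Y : Type u} [MeasurableSpace Y] (W : Kernel (Fin q) Y)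
    [IsMarkovKernel W] : ℝ :=
  ∫ y, ((q : ℝ) * ∑ i : Fin q, ((posterior W (uniformColour q)) y).real {i} ^ 2 - 1)
    ∂((uniformColour q).bind W)

end

/-!
Let `T`, `ω` and `L` be the tree and the survey up to depth `k` and the colours at distance `k`. The
idea is that the survey alone carries less information about the root than the leaves do, so that
the leaves still have something to add.

By the chain rule (`mutualInfo_prodMk_eq_add`), `I(σ_ρ; L | T, ω) = I(σ_ρ; T, ω, L) - I(σ_ρ; T, ω)`
(`channelInfo_add_leafInfoGivenSurvey`). The first term is nonincreasing in `k`: given the survey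
and the colours at distance `k`, what lies below is independent of the root, so that passing to
`k + 1` is a degradation of the channel (`isDegradation_leafChannel_succ`). The second term is
nondecreasing, as the survey up to depth `k` is a function of that up to depth `k + 1`
(`isDegradation_treeChannel_succ`). Hence the difference is nonincreasing and has a limit. The
first term is at least `I(σ_ρ; L | T)` (`leafInfo_le_channelInfo_leafChannel`), whose limit is
positive by hypothesis. It remains to see that the survey alone carries little information about
the root, uniformly in `k`, when the channel at each vertex does.

This is where `d * lam ^ 2 < 1` enters. Let `s` bound the `χ²`-information of a channel
(`ChiSqBound`), up to the factor `q`. Passing through an edge multiplies `s` by `lam ^ 2`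
(`ChiSqBound.potts`). The bounds `s` and `s'` of two conditionally independent observations combine
to `s + s' + K * s * s'` with `K` depending on `q` only (`ChiSqBound.prod`): the output law of the
pair is the product law up to a factor `1 + r`, where `r` is of first order in each observation,
and the third order terms in the deviations integrate to zero. In other words,
`1 + K * s` is multiplicative. For a random number of children with mean `d` this gives
`1 + K * s ↦ (1 + K * s₀) * exp (d * lam ^ 2 * K * s)` (`ChiSqBound.branchStep`), where `s₀` belongs
to the observation at the root. As `d * lam ^ 2 < 1`, arbitrarily small `s` are reproduced by this
recursion once `s₀` is small enough (`exists_invariant_bound`). For the channel at a vertex one can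
take `q` times its `χ²`-capacity as `s₀` (`chiSqBound_chiSqCapacity`), and the mutual information is
at most the `χ²`-information (`ChiSqBound.channelInfo_le`).
-/

noncomputable section

/-! ### Mutual information -/

section MutualInformation

variable {Ω : Type*} {α : Type*} {β : Type*} {γ : Type*} {δ : Type*} [MeasurableSpace Ω]
  [MeasurableSpace α] [MeasurableSpace β] [MeasurableSpace γ] [MeasurableSpace δ]

/-- The mutual information `I(A; C) = D(P_{AC} ‖ P_A P_C)` of two random variables. -/
def mutualInfo (P : Measure Ω) (A : Ω → α) (C : Ω → γ) : ℝ≥0∞ :=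
  klDiv (P.map fun x => (A x, C x)) ((P.map A).prod (P.map C))

theorem klDiv_map_measurableEquiv (e : α ≃ᵐ β) (μ ν : Measure α) [IsFiniteMeasure μ]
    [IsFiniteMeasure ν] : klDiv (μ.map e) (ν.map e) = klDiv μ ν := by
  refine le_antisymm (klDiv_map_le _ _ e.measurable) ?_
  have h := klDiv_map_le (μ.map e) (ν.map e) e.symm.measurable
  simpa [Measure.map_map e.symm.measurable e.measurable] using h

theorem mutualInfo_comp_le (P : Measure Ω) [IsFiniteMeasure P] {A : Ω → α} {C : Ω → γ}
    (hA : Measurable A) (hC : Measurable C) {g : γ → δ} (hg : Measurable g) :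
    mutualInfo P A (fun x => g (C x)) ≤ mutualInfo P A C := by
  have h := klDiv_map_le (P.map fun x => (A x, C x)) ((P.map A).prod (P.map C))
    (measurable_id.prodMap hg)
  rw [Measure.map_map (by fun_prop) (by fun_prop), ← Measure.map_prod_map _ _ measurable_id hg,
    Measure.map_id, Measure.map_map hg hC] at h
  exact h

/-- Mutual information is invariant under a function with a measurable left inverse on the values of
`C`. -/
theorem mutualInfo_comp_equiv (P : Measure Ω) [IsFiniteMeasure P] {A : Ω → α} {C : Ω → γ}
    (hA : Measurable A) (hC : Measurable C) {g : γ → δ} (hg : Measurable g)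
    {h : δ → γ} (hh : Measurable h) (hhg : ∀ x, h (g (C x)) = C x) :
    mutualInfo P A (fun x => g (C x)) = mutualInfo P A C := by
  refine le_antisymm (mutualInfo_comp_le P hA hC hg) ?_
  have := mutualInfo_comp_le P hA (hg.comp hC) hh
  simp only [Function.comp_apply, hhg] at this
  exact this

/-- The chain rule `I(A; C, B) = I(A; C) + I(A; B | C)`. -/
theorem mutualInfo_prodMk_eq_add [StandardBorelSpace α] [Nonempty α] [StandardBorelSpace β]
    [Nonempty β] (P : Measure Ω) [IsFiniteMeasure P] {A : Ω → α} {B : Ω → β} {C : Ω → γ}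
    (hA : Measurable A) (hB : Measurable B) (hC : Measurable C) :
    mutualInfo P A (fun x => (C x, B x)) = mutualInfo P A C + condMutualInfo P A B C := by
  set κ := condDistrib B (fun x => (A x, C x)) P with hκ
  set η := (condDistrib B C P).prodMkLeft α with hη
  have h := klDiv_compProd_eq_add (P.map fun x => (A x, C x)) ((P.map A).prod (P.map C)) κ η
  have h1 : (P.map fun x => (A x, C x)) ⊗ₘ κ = P.map fun x => ((A x, C x), B x) :=
    compProd_map_condDistrib hB.aemeasurable
  -- the intermediate law is `P_A P_C P_{B|C}`, which is `P_A P_{CB}`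
  have h2 : ((P.map A).prod (P.map C) ⊗ₘ η).map MeasurableEquiv.prodAssoc
      = (P.map A).prod (P.map fun x => (C x, B x)) := by
    rw [← compProd_map_condDistrib hB.aemeasurable]
    refine Measure.ext_of_lintegral _ fun f hf => ?_
    rw [lintegral_map hf (by fun_prop), Measure.lintegral_compProd (by fun_prop),
      lintegral_prod _ (Measurable.lintegral_kernel_prod_right' (κ := η)
        (f := fun p : (α × γ) × β => f (MeasurableEquiv.prodAssoc p)) (by fun_prop)).aemeasurable,
      lintegral_prod _ (by fun_prop)]
    refine lintegral_congr fun a => ?_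
    rw [Measure.lintegral_compProd (by fun_prop)]
    rfl
  have h3 : (P.map fun x => ((A x, C x), B x)).map MeasurableEquiv.prodAssoc
      = P.map fun x => (A x, (C x, B x)) := by
    rw [Measure.map_map (by fun_prop) (by fun_prop)]; rfl
  -- likewise `P_{AC} P_{B|C}` is `P_C P_{A|C} P_{B|C}`
  have h4 : (P.map (fun x => (A x, C x)) ⊗ₘ η).map
        (fun p : (α × γ) × β => (p.1.2, p.1.1, p.2))
      = (P.map C) ⊗ₘ (condDistrib A C P ×ₖ condDistrib B C P) := by
    refine Measure.ext_of_lintegral _ fun f hf => ?_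
    rw [lintegral_map hf (by fun_prop), Measure.lintegral_compProd (by fun_prop),
      Measure.lintegral_compProd (by fun_prop)]
    have hm : Measurable fun p : α × γ => ∫⁻ b, f (p.2, p.1, b) ∂(condDistrib B C P) p.2 :=
      Measurable.lintegral_kernel_prod_right' (κ := η)
        (f := fun p : (α × γ) × β => f (p.1.2, p.1.1, p.2)) (by fun_prop)
    have h5 : P.map (fun x => (A x, C x))
        = ((P.map C) ⊗ₘ condDistrib A C P).map Prod.swap := by
      rw [compProd_map_condDistrib hA.aemeasurable, Measure.map_map (by fun_prop) (by fun_prop)]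
      rfl
    rw [h5, lintegral_map (by exact hm) (by fun_prop),
      Measure.lintegral_compProd (by exact hm.comp measurable_swap)]
    refine lintegral_congr fun c => ?_
    rw [Kernel.prod_apply, lintegral_prod _ (by fun_prop)]
    rfl
  have h6 : klDiv (P.map (fun x => ((A x, C x), B x)))
      (P.map (fun x => (A x, C x)) ⊗ₘ η) = condMutualInfo P A B C := by
    let e : (α × γ) × β ≃ᵐ γ × α × β :=
      (MeasurableEquiv.prodComm.prodCongr (MeasurableEquiv.refl β)).trans
        MeasurableEquiv.prodAssoc
    rw [← klDiv_map_measurableEquiv e, condMutualInfo]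
    congr 1
    rw [Measure.map_map (by fun_prop) (by fun_prop)]; rfl
  rw [mutualInfo, mutualInfo, ← h3, ← h2, klDiv_map_measurableEquiv, ← h1, h, h1, h6]

end MutualInformation

/-! ### Degraded channels -/

section Degraded

variable {ι : Type*} {Z : Type*} {Z' : Type*} [MeasurableSpace Z] [MeasurableSpace Z']

/-- The channel `N` is a degradation of the channel `M`: its output can be simulated from the
output of `M` by means of a Markov kernel. -/
def IsDegradation (N : ι → Measure Z') (M : ι → Measure Z) : Prop :=
  ∃ K : Kernel Z Z', IsMarkovKernel K ∧ ∀ i, N i = (M i).bind K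

theorem IsDegradation.of_map {N : ι → Measure Z'} {M : ι → Measure Z} {f : Z → Z'}
    (hf : Measurable f) (h : ∀ i, N i = (M i).map f) : IsDegradation N M :=
  ⟨Kernel.deterministic f hf, inferInstance, fun i => by
    rw [Measure.deterministic_comp_eq_map]; exact h i⟩

theorem IsDegradation.map {N : ι → Measure Z'} {M : ι → Measure Z} (h : IsDegradation N M)
    {Z'' : Type*} [MeasurableSpace Z''] {f : Z' → Z''} (hf : Measurable f) :
    IsDegradation (fun i => (N i).map f) M := by
  obtain ⟨K, hK, hN⟩ := h
  refine ⟨K.map f, Kernel.IsMarkovKernel.map K hf, fun i => ?_⟩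
  simp only [hN, Measure.map_comp _ _ hf]

/-- An injective recoding of the output with a measurable left inverse loses nothing. -/
theorem IsDegradation.of_map_right {N : ι → Measure Z'} {M : ι → Measure Z}
    {Z'' : Type*} [MeasurableSpace Z''] {f : Z → Z''} {g : Z'' → Z} (hf : Measurable f)
    (hg : Measurable g) (hgf : ∀ z, g (f z) = z) (h : IsDegradation N M) :
    IsDegradation N (fun i => (M i).map f) := by
  obtain ⟨K, hK, hN⟩ := h
  refine ⟨K.comap g hg, inferInstance, fun i => ?_⟩
  have h : K.comap g hg ∘ₖ Kernel.deterministic f hf = K := by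
    ext z : 1
    rw [Kernel.comp_deterministic_eq_comap, Kernel.comap_apply, Kernel.comap_apply, hgf]
  rw [hN]
  change _ = (K.comap g hg) ∘ₘ ((M i).map f)
  rw [← Measure.deterministic_comp_eq_map hf, Measure.comp_assoc, h]

/-- The mutual information between the input and the output of a channel cannot increase under
degradation. -/
theorem IsDegradation.klDiv_compProd_le [MeasurableSpace ι] {N : Kernel ι Z'} {M : Kernel ι Z}
    [IsMarkovKernel N] [IsMarkovKernel M] (h : IsDegradation N M) (U : Measure ι)
    [IsProbabilityMeasure U] :
    klDiv (U ⊗ₘ N) (U.prod (U.bind N)) ≤ klDiv (U ⊗ₘ M) (U.prod (U.bind M)) := by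
  obtain ⟨K, hK, hN⟩ := h
  have hN' : N = K ∘ₖ M := by
    ext i : 1
    rw [Kernel.comp_apply]; exact hN i
  have h := klDiv_comp_right_le (U ⊗ₘ M) (U.prod (U.bind M)) (Kernel.id ∥ₖ K)
  rw [Measure.parallelComp_comp_compProd] at h
  have h2 : (Kernel.id ∥ₖ K) ∘ₘ (U.prod (U.bind M)) = U.prod (U.bind N) := by
    rw [← Measure.compProd_const, Measure.parallelComp_comp_compProd, hN', ← Measure.comp_assoc,
      Kernel.comp_const, Measure.compProd_const]
  rw [h2, ← hN'] at h
  exact h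

end Degraded

/-! ### Random forests -/

section Forest

variable {α : Type u} {β : Type v} {γ : Type w} [MeasurableSpace α] [MeasurableSpace β]
  [MeasurableSpace γ]

theorem Branches.measurable_of_mk {F : Branches α → γ}
    (h : ∀ b, Measurable fun f => F (Branches.mk b f)) : Measurable F :=
  fun _ hs => MeasurableSpace.measurableSet_iInf.2 fun b => h b hs

/-- The function `f` applied to every subtree. -/
def Branches.map {α : Type u} {β : Type v} (f : α → β) (t : Branches α) : Branches β :=
  Branches.mk t.1 fun j => f (t.2 j)

@[fun_prop]
theorem Branches.measurable_map {f : α → β} (hf : Measurable f) : Measurable (Branches.map f) :=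
  Branches.measurable_of_mk fun b =>
    (Branches.measurable_mk b).comp
      (measurable_pi_lambda _ fun j => hf.comp (measurable_pi_apply j))

/-- Pairs of tuples of equal length, as tuples of pairs. Pairs of tuples of different lengths are
sent to the empty tuple. -/
def Branches.zip {α : Type u} {β : Type v} (p : Branches α × Branches β) : Branches (α × β) :=
  if h : p.1.1 = p.2.1 then Branches.mk p.1.1 fun j => (p.1.2 j, p.2.2 (Fin.cast h j))
  else Branches.mk 0 Fin.elim0

theorem Branches.zip_map {α : Type u} {β : Type v} (t : Branches (α × β)) :
    Branches.zip (t.map Prod.fst, t.map Prod.snd) = t := by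
  obtain ⟨b, f⟩ := t
  simp [Branches.zip, Branches.map, Branches.mk]

theorem Branches.measurable_zip [Countable β] [DiscreteMeasurableSpace β] :
    Measurable (Branches.zip : Branches α × Branches β → Branches (α × β)) := by
  have : DiscreteMeasurableSpace (Branches β) := sigma_discreteMeasurableSpace
  refine measurable_from_prod_countable_left fun s => Branches.measurable_of_mk fun b => ?_
  by_cases h : b = s.1
  · have e (f : Fin b → α) : Branches.zip (Branches.mk b f, s)
        = Branches.mk b fun j => (f j, s.2 (Fin.cast h j)) := dif_pos h
    simp only [e]
    exact (Branches.measurable_mk b).comp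
      (measurable_pi_lambda _ fun j => (measurable_pi_apply j).prodMk measurable_const)
  · have e (f : Fin b → α) : Branches.zip (Branches.mk b f, s)
        = Branches.mk 0 Fin.elim0 := dif_neg h
    simp only [e]
    exact measurable_const

/-- The law of a random number of independent random objects: their number has law `D` and each
of them has law `μ`. -/
def forest (D : Measure ℕ) (μ : Measure α) : Measure (Branches α) :=
  D.bind fun b => (Measure.pi fun _ : Fin b => μ).map (Branches.mk b)

instance forest.instIsProbabilityMeasure (D : Measure ℕ) (μ : Measure α) [IsProbabilityMeasure D]
    [IsProbabilityMeasure μ] : IsProbabilityMeasure (forest D μ) :=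
  isProbabilityMeasure_bind_sigma D _

theorem lintegral_forest (D : Measure ℕ) (μ : Measure α) {F : Branches α → ℝ≥0∞}
    (hF : Measurable F) :
    ∫⁻ t, F t ∂(forest D μ) =
      ∫⁻ b, ∫⁻ f, F (Branches.mk b f) ∂(Measure.pi fun _ : Fin b => μ) ∂D := by
  rw [forest, Measure.lintegral_bind (measurable_of_countable _).aemeasurable hF.aemeasurable]
  exact lintegral_congr fun b => lintegral_map hF (Branches.measurable_mk b)

theorem forest_map (D : Measure ℕ) (μ : Measure α) [IsProbabilityMeasure μ] {f : α → β}
    (hf : Measurable f) : (forest D μ).map (Branches.map f) = forest D (μ.map f) := by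
  have : IsProbabilityMeasure (μ.map f) := Measure.isProbabilityMeasure_map hf.aemeasurable
  refine Measure.ext_of_lintegral _ fun F hF => ?_
  rw [lintegral_map hF (Branches.measurable_map hf),
    lintegral_forest _ _ (by fun_prop), lintegral_forest _ _ hF]
  refine lintegral_congr fun b => ?_
  rw [← Measure.pi_map_pi fun _ => hf.aemeasurable,
    lintegral_map (by exact hF.comp (Branches.measurable_mk b)) (by fun_prop)]
  rfl

theorem measurable_pi_kernel {ι : Type*} [Fintype ι] (K : Kernel α β) [IsMarkovKernel K] :
    Measurable fun f : ι → α => Measure.pi fun j => K (f j) := by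
  refine Measurable.measure_of_isPiSystem_of_isProbabilityMeasure generateFrom_pi.symm
    isPiSystem_pi ?_
  rintro _ ⟨s, hs, rfl⟩
  simp only [Measure.pi_pi]
  exact Finset.measurable_fun_prod _ fun j _ =>
    (Kernel.measurable_coe K (hs j (Set.mem_univ j))).comp (measurable_pi_apply j)

/-- The kernel `K` applied independently to every subtree. -/
def forestKernel (K : Kernel α β) [IsMarkovKernel K] : Kernel (Branches α) (Branches β) where
  toFun t := (Measure.pi fun j => K (t.2 j)).map (Branches.mk t.1)
  measurable' := Branches.measurable_of_mk fun b =>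
    (Measure.measurable_map _ (Branches.measurable_mk b)).comp
      (measurable_pi_kernel (ι := Fin b) K)

theorem forestKernel_apply (K : Kernel α β) [IsMarkovKernel K] (t : Branches α) :
    forestKernel K t = (Measure.pi fun j => K (t.2 j)).map (Branches.mk t.1) := rfl

instance forestKernel.instIsMarkovKernel (K : Kernel α β) [IsMarkovKernel K] :
    IsMarkovKernel (forestKernel K) :=
  ⟨fun t => Measure.isProbabilityMeasure_map (Branches.measurable_mk t.1).aemeasurable⟩

theorem lintegral_pi_prod {ι : Type*} [Fintype ι] (μ : ι → Measure α)
    [∀ i, IsProbabilityMeasure (μ i)] {F : ι → α → ℝ≥0∞} (hF : ∀ i, Measurable (F i)) :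
    ∫⁻ f, ∏ i, F i (f i) ∂(Measure.pi μ) = ∏ i, ∫⁻ x, F i x ∂(μ i) := by
  refine (lintegral_prod_eq_prod_lintegral_of_indepFun Finset.univ
    (fun i (f : ι → α) => F i (f i))
    (iIndepFun_pi fun i => (hF i).aemeasurable)
    fun i => (hF i).comp (measurable_pi_apply i)).trans ?_
  exact Finset.prod_congr rfl fun i _ => (measurePreserving_eval μ i).lintegral_comp (hF i)

/-- A kernel applied to independent inputs yields independent outputs. -/
theorem pi_bind {ι : Type*} [Fintype ι] (μ : Measure α) [IsProbabilityMeasure μ]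
    (K : Kernel α β) [IsMarkovKernel K] :
    (Measure.pi fun _ : ι => μ.bind K)
      = (Measure.pi fun _ : ι => μ).bind fun f => Measure.pi fun j => K (f j) := by
  refine Measure.pi_eq fun s hs => ?_
  rw [Measure.bind_apply (MeasurableSet.univ_pi hs) (measurable_pi_kernel K).aemeasurable]
  simp only [Measure.pi_pi]
  rw [lintegral_pi_prod _ fun i => Kernel.measurable_coe K (hs i)]
  exact Finset.prod_congr rfl fun i _ =>
    (Measure.bind_apply (hs i) (Kernel.measurable K).aemeasurable).symm

theorem forest_bind (D : Measure ℕ) (μ : Measure α) [IsProbabilityMeasure μ] (K : Kernel α β)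
    [IsMarkovKernel K] : forest D (μ.bind K) = (forest D μ).bind (forestKernel K) := by
  refine Measure.ext_of_lintegral _ fun F hF => ?_
  rw [Measure.lintegral_bind (Kernel.measurable _).aemeasurable hF.aemeasurable,
    lintegral_forest _ _ hF, lintegral_forest _ _ hF.lintegral_kernel]
  refine lintegral_congr fun b => ?_
  rw [pi_bind, Measure.lintegral_bind (measurable_pi_kernel K).aemeasurable
    (by exact (hF.comp (Branches.measurable_mk b)).aemeasurable)]
  exact lintegral_congr fun f => (lintegral_map hF (Branches.measurable_mk b)).symm

/-- Independent pairs consist of independent first coordinates and second coordinates which are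
conditionally independent given the first ones. -/
theorem forest_compProd_map (D : Measure ℕ) [IsProbabilityMeasure D] (μ : Measure α)
    [IsProbabilityMeasure μ] (K : Kernel α β) [IsMarkovKernel K] :
    (forest D (μ ⊗ₘ K)).map (fun t => (t.map Prod.fst, t.map Prod.snd))
      = forest D μ ⊗ₘ forestKernel K := by
  have hm : Measurable fun t : Branches (α × β) => (t.map Prod.fst, t.map Prod.snd) :=
    (Branches.measurable_map measurable_fst).prodMk (Branches.measurable_map measurable_snd)
  refine Measure.ext_of_lintegral _ fun F hF => ?_
  rw [Measure.compProd_eq_comp_prod, forest_bind, lintegral_map hF hm,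
    Measure.lintegral_bind (Kernel.measurable _).aemeasurable (by exact (hF.comp hm).aemeasurable),
    Measure.lintegral_compProd hF]
  refine lintegral_congr fun t => ?_
  have h : (Measure.pi fun j => (Kernel.id ×ₖ K) (t.2 j))
      = (Measure.pi fun j => K (t.2 j)).map fun b j => (t.2 j, b j) := by
    have (j : Fin t.1) : (Kernel.id ×ₖ K) (t.2 j) = (K (t.2 j)).map (Prod.mk (t.2 j)) := by
      rw [Kernel.prod_apply, Kernel.id_apply, Measure.dirac_prod]
    simp only [this]
    have (j : Fin t.1) : IsProbabilityMeasure ((K (t.2 j)).map (Prod.mk (t.2 j))) :=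
      Measure.isProbabilityMeasure_map (by fun_prop)
    exact (Measure.pi_map_pi fun j => (measurable_prodMk_left).aemeasurable).symm
  rw [forestKernel_apply, h, Measure.map_map (Branches.measurable_mk _) (by fun_prop),
    lintegral_map (by exact hF.comp hm) ((Branches.measurable_mk _).comp (by fun_prop)),
    forestKernel_apply, lintegral_map (by exact hF.comp measurable_prodMk_left)
      (Branches.measurable_mk _)]
  rfl

end Forest

/-! ### Relabelling trees -/

section Relabel

variable {α : Type u} {β : Type v} [MeasurableSpace α] [MeasurableSpace β]

/-- The function `f` applied to every label. -/
def LTree.relabel {α : Type u} {β : Type v} (f : α → β) : {k : ℕ} → LTree α k → LTree β k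
  | 0, a => f a
  | k + 1, t => (f t.1, Branches.map (LTree.relabel f (k := k)) t.2)

theorem LTree.measurable_relabel {f : α → β} (hf : Measurable f) :
    (k : ℕ) → Measurable (LTree.relabel f : LTree α k → LTree β k)
  | 0 => hf
  | k + 1 => (hf.comp measurable_fst).prodMk
      ((Branches.measurable_map (LTree.measurable_relabel hf k)).comp measurable_snd)

theorem LTree.measurable_root : (k : ℕ) → Measurable (LTree.root : LTree α k → α)
  | 0 => measurable_id
  | _ + 1 => measurable_fst

theorem LTree.measurable_leaves :
    (k : ℕ) → Measurable (LTree.leaves : LTree α k → LeafLabels α k)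
  | 0 => measurable_id
  | k + 1 => (Branches.measurable_map (LTree.measurable_leaves k)).comp measurable_snd

theorem LTree.measurable_shape : (k : ℕ) → Measurable (LTree.shape : LTree α k → LTree Unit k)
  | 0 => measurable_const
  | k + 1 => measurable_const.prodMk
      ((Branches.measurable_map (LTree.measurable_shape k)).comp measurable_snd)

theorem LTree.shape_relabel {α : Type u} {β : Type v} (f : α → β) :
    {k : ℕ} → (t : LTree α k) → (t.relabel f).shape = t.shape
  | 0, _ => rfl
  | k + 1, t => by
    simp only [LTree.shape, LTree.relabel, Branches.map, Branches.mk]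
    congr 2
    funext j
    exact LTree.shape_relabel f (t.2.2 j)

/-- The tree with its vertices at maximal distance from the root removed. -/
def LTree.truncate {α : Type u} : (k : ℕ) → LTree α (k + 1) → LTree α k
  | 0, t => t.1
  | k + 1, t => (t.1, Branches.map (LTree.truncate k) t.2)

theorem LTree.measurable_truncate :
    (k : ℕ) → Measurable (LTree.truncate k : LTree α (k + 1) → LTree α k)
  | 0 => measurable_fst
  | k + 1 => measurable_fst.prodMk
      ((Branches.measurable_map (LTree.measurable_truncate k)).comp measurable_snd)

end Relabel

/-! ### Tree channels -/

section TreeChannel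

variable {q : ℕ} (lam : PottsRange q) (t : TreeKind) {X : Type u} {Z : Type v} {Z' : Type w}
  [MeasurableSpace X] [MeasurableSpace Z] [MeasurableSpace Z']

/-- The channel from the colour of a vertex whose output consists of the output of the channel `V`
at this vertex and the outputs of the channel `M` at its children. -/
def branchStep (V : Kernel (Fin q) X) (M : Kernel (Fin q) Z) : Kernel (Fin q) (X × Branches Z) :=
  Kernel.ofFunOfCountable fun i => (V i).prod (forest t.offspring ((pottsChannel q lam i).bind M))

theorem branchStep_apply (V : Kernel (Fin q) X) (M : Kernel (Fin q) Z) (i : Fin q) :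
    branchStep lam t V M i =
      (V i).prod (forest t.offspring ((pottsChannel q lam i).bind M)) := rfl

theorem isProbabilityMeasure_bind_kernel {α : Type*} {β : Type*} [MeasurableSpace α]
    [MeasurableSpace β] (μ : Measure α) [IsProbabilityMeasure μ] (K : Kernel α β)
    [IsMarkovKernel K] : IsProbabilityMeasure (μ.bind K) :=
  isProbabilityMeasure_bind (Kernel.measurable _).aemeasurable (ae_of_all _ fun _ => inferInstance)

instance branchStep.instIsMarkovKernel (V : Kernel (Fin q) X) (M : Kernel (Fin q) Z)
    [IsMarkovKernel V] [IsMarkovKernel M] : IsMarkovKernel (branchStep lam t V M) :=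
  ⟨fun i => by
    have := isProbabilityMeasure_bind_kernel (pottsChannel q lam i) M
    rw [branchStep_apply]
    infer_instance⟩

theorem branchStep_map (V : Kernel (Fin q) X) (M : Kernel (Fin q) Z) [IsMarkovKernel V]
    [IsMarkovKernel M] {X' : Type*} [MeasurableSpace X'] {f : X → X'} (hf : Measurable f)
    {g : Z → Z'} (hg : Measurable g) :
    (branchStep lam t V M).map (Prod.map f (Branches.map g))
      = branchStep lam t (V.map f) (M.map g) := by
  ext i : 1
  have := isProbabilityMeasure_bind_kernel (pottsChannel q lam i) M
  rw [Kernel.map_apply _ (hf.prodMap (Branches.measurable_map hg)), branchStep_apply,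
    branchStep_apply, ← Measure.map_prod_map _ _ hf (Branches.measurable_map hg),
    forest_map _ _ hg, Kernel.map_apply _ hf, Measure.map_comp _ _ hg]

theorem bind_isDegradation {N : Kernel (Fin q) Z'} {M : Kernel (Fin q) Z} {K : Kernel Z Z'}
    (h : ∀ i, N i = (M i).bind K) (μ : Measure (Fin q)) : μ.bind N = (μ.bind M).bind K := by
  have hN : N = K ∘ₖ M := by
    ext i : 1
    rw [Kernel.comp_apply]; exact h i
  rw [hN, Measure.comp_assoc]

theorem IsDegradation.branchStep (V : Kernel (Fin q) X) [IsMarkovKernel V]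
    {N : Kernel (Fin q) Z'} {M : Kernel (Fin q) Z} [IsMarkovKernel M]
    (h : IsDegradation N M) :
    IsDegradation (branchStep lam t V N) (branchStep lam t V M) := by
  obtain ⟨K, hK, hN⟩ := h
  refine ⟨Kernel.id ∥ₖ forestKernel K, inferInstance, fun i => ?_⟩
  have := isProbabilityMeasure_bind_kernel (pottsChannel q lam i) M
  rw [branchStep_apply, branchStep_apply, bind_isDegradation hN, forest_bind,
    Measure.prod_comp_right]

/-- The channel from the colour of the root whose output is the tree of depth `k` with every vertex
labelled by the output of the channel `V` applied to the colour of this vertex. -/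
def treeChannel (V : Kernel (Fin q) X) : (k : ℕ) → Kernel (Fin q) (LTree X k)
  | 0 => V
  | k + 1 => branchStep lam t V (treeChannel V k)

instance treeChannel.instIsMarkovKernel (V : Kernel (Fin q) X) [IsMarkovKernel V] :
    (k : ℕ) → IsMarkovKernel (treeChannel lam t V k)
  | 0 => inferInstanceAs (IsMarkovKernel V)
  | k + 1 =>
    have := treeChannel.instIsMarkovKernel V k
    inferInstanceAs (IsMarkovKernel (branchStep lam t V (treeChannel lam t V k)))

theorem treeChannel_map (V : Kernel (Fin q) X) [IsMarkovKernel V] {X' : Type w}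
    [MeasurableSpace X'] {f : X → X'} (hf : Measurable f) :
    (k : ℕ) → (treeChannel lam t V k).map (LTree.relabel f) = treeChannel lam t (V.map f) k
  | 0 => rfl
  | k + 1 => by
    have h := branchStep_map lam t V (treeChannel lam t V k) hf (LTree.measurable_relabel hf k)
    rw [treeChannel_map V hf k] at h
    exact h

/-- The tree labelled by observations of the colours of its vertices is a degradation of the
next larger one. -/
theorem isDegradation_treeChannel_succ (V : Kernel (Fin q) X) [IsMarkovKernel V] :
    (k : ℕ) → IsDegradation (treeChannel lam t V k) (treeChannel lam t V (k + 1)) := by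
  intro k
  refine .of_map (LTree.measurable_truncate k) fun i => ?_
  induction k generalizing i with
  | zero =>
    have := isProbabilityMeasure_bind_kernel (pottsChannel q lam i) (treeChannel lam t V 0)
    change V i = ((V i).prod _).map Prod.fst
    simp
  | succ k ih =>
    have h : treeChannel lam t V k = (treeChannel lam t V (k + 1)).map (LTree.truncate k) := by
      ext i : 1
      rw [Kernel.map_apply _ (LTree.measurable_truncate k), ih]
    have h2 := branchStep_map lam t V (treeChannel lam t V (k + 1)) measurable_id
      (LTree.measurable_truncate k)
    rw [← h, Kernel.map_id] at h2
    have h3 := DFunLike.congr_fun h2 i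
    rw [Kernel.map_apply _ (measurable_id.prodMap
      (Branches.measurable_map (LTree.measurable_truncate k)))] at h3
    exact h3.symm

end TreeChannel

/-! ### Colours together with observations -/

section Survey

variable {q : ℕ} (lam : PottsRange q) (t : TreeKind) {Y : Type u} [MeasurableSpace Y]
  (W : Kernel (Fin q) Y) [IsMarkovKernel W]

/-- Induction step for `treeChannel_prod_map`, where `u` splits the data at a subtree into the
coloured subtree and its survey. -/
theorem branchStep_prod_map {Z : Type u} {A : Type v} {B : Type w} [MeasurableSpace Z]
    [MeasurableSpace A] [MeasurableSpace B] (M : Kernel (Fin q) Z) [IsMarkovKernel M]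
    (P : Kernel (Fin q) A) [IsMarkovKernel P] (S : Kernel A B) [IsMarkovKernel S] {u : Z → A × B}
    (hu : Measurable u) (h : ∀ i, (M i).map u = P i ⊗ₘ S)
    (K : Kernel (Fin q × Branches A) (Y × Branches B))
    (hK : ∀ s, K s = (W s.1).prod (forestKernel S s.2)) (i : Fin q) :
    (branchStep lam t (Kernel.id ×ₖ W) M i).map (fun s =>
        ((s.1.1, s.2.map fun z => (u z).1), (s.1.2, s.2.map fun z => (u z).2)))
      = (Measure.dirac i).prod (forest t.offspring ((pottsChannel q lam i).bind P)) ⊗ₘ K := by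
  set μ := (pottsChannel q lam i).bind M with hμ
  set ν := (pottsChannel q lam i).bind P with hν
  have : IsProbabilityMeasure μ := isProbabilityMeasure_bind_kernel _ _
  have : IsProbabilityMeasure ν := isProbabilityMeasure_bind_kernel _ _
  have : IsMarkovKernel K := ⟨fun s => by rw [hK]; infer_instance⟩
  have h1 : μ.map u = ν ⊗ₘ S := by
    rw [hμ, Measure.map_comp _ _ hu, hν, Measure.compProd_eq_comp_prod, Measure.comp_assoc]
    congr 1
    ext i : 1
    rw [Kernel.map_apply _ hu, h, Kernel.comp_apply, Measure.compProd_eq_comp_prod]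
  have h2 := forest_compProd_map t.offspring ν S
  rw [← h1, ← forest_map _ _ hu, Measure.map_map
    ((Branches.measurable_map measurable_fst).prodMk (Branches.measurable_map measurable_snd))
    (Branches.measurable_map hu)] at h2
  have hm1 : Measurable fun s : Branches Z => s.map fun z => (u z).1 :=
    Branches.measurable_map (by fun_prop)
  have hm2 : Measurable fun s : Branches Z => s.map fun z => (u z).2 :=
    Branches.measurable_map (by fun_prop)
  refine Measure.ext_of_lintegral _ fun F hF => ?_
  rw [lintegral_map hF (by fun_prop), branchStep_apply, Kernel.prod_apply, Kernel.id_apply,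
    lintegral_prod _ (by fun_prop), lintegral_prod _ (by fun_prop), lintegral_dirac,
    Measure.lintegral_compProd hF,
    lintegral_prod _ hF.lintegral_kernel_prod_right'.aemeasurable, lintegral_dirac,
    lintegral_lintegral_swap (by fun_prop)]
  have h3 : ∀ G : Branches A × Branches B → ℝ≥0∞, Measurable G →
      ∫⁻ s, G (s.map fun z => (u z).1, s.map fun z => (u z).2) ∂(forest t.offspring μ)
        = ∫⁻ r, ∫⁻ r', G (r, r') ∂(forestKernel S r) ∂(forest t.offspring ν) := by
    intro G hG
    rw [← Measure.lintegral_compProd hG, ← h2, lintegral_map hG (by fun_prop)]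
    rfl
  rw [h3 (fun p => ∫⁻ y, F ((i, p.1), (y, p.2)) ∂(W i))
    (Measurable.lintegral_prod_right' (f := fun p : (Branches A × Branches B) × Y =>
      F ((i, p.1.1), (p.2, p.1.2))) (by fun_prop))]
  refine lintegral_congr fun r => ?_
  rw [hK, lintegral_prod _ (by fun_prop), lintegral_lintegral_swap (by fun_prop)]

/-- The coloured tree together with its survey is the tree with every vertex labelled by its colour
and its observation. -/
theorem treeChannel_prod_map (k : ℕ) (i : Fin q) :
    (treeChannel lam t (Kernel.id ×ₖ W) k i).map
        (fun s => (s.relabel Prod.fst, s.relabel Prod.snd))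
      = pottsTree q lam t k i ⊗ₘ surveyKernel W k := by
  induction k generalizing i with
  | zero =>
    have h : (Kernel.id ×ₖ W) i = Kernel.id i ⊗ₘ W := by
      rw [Kernel.prod_apply, Kernel.id_apply]
      refine Measure.ext_of_lintegral _ fun F hF => ?_
      rw [Measure.lintegral_compProd hF, lintegral_prod _ hF.aemeasurable, lintegral_dirac,
        lintegral_dirac]
    have h' : surveyKernel W 0 = W := Kernel.ext fun _ => rfl
    rw [h']
    exact (Measure.map_id (μ := (Kernel.id ×ₖ W) i)).trans h
  | succ k ih =>
    have h := branchStep_prod_map lam t W (treeChannel lam t (Kernel.id ×ₖ W) k)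
      (pottsTree q lam t k) (surveyKernel W k)
      ((LTree.measurable_relabel measurable_fst k).prodMk
        (LTree.measurable_relabel measurable_snd k)) ih
      (surveyKernel W (k + 1)) (fun _ => rfl) i
    exact h

theorem treeChannel_map_root {X : Type u} [MeasurableSpace X] (V : Kernel (Fin q) X)
    [IsMarkovKernel V] : (k : ℕ) → (i : Fin q) → (treeChannel lam t V k i).map LTree.root = V i
  | 0, i => Measure.map_id (μ := V i)
  | k + 1, i => by
    have := isProbabilityMeasure_bind_kernel (pottsChannel q lam i) (treeChannel lam t V k)
    change ((V i).prod (forest t.offspring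
      ((pottsChannel q lam i).bind (treeChannel lam t V k)))).map Prod.fst = V i
    simp

variable (Y) in
/-- The observations at all vertices and the colours at maximal distance from the root. -/
def leafView (k : ℕ) (s : LTree (Fin q × Y) k) : LTree Y k × LeafLabels (Fin q) k :=
  (s.relabel Prod.snd, (s.relabel Prod.fst).leaves)

theorem measurable_leafView (k : ℕ) : Measurable (leafView Y (q := q) k) :=
  (LTree.measurable_relabel measurable_snd k).prodMk
    ((LTree.measurable_leaves k).comp (LTree.measurable_relabel measurable_fst k))

/-- The channel from the colour of the root to the survey together with the colours at
maximal distance from the root. -/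
def leafChannel (k : ℕ) : Kernel (Fin q) (LTree Y k × LeafLabels (Fin q) k) :=
  (treeChannel lam t (Kernel.id ×ₖ W) k).map (leafView Y k)

instance leafChannel.instIsMarkovKernel (k : ℕ) : IsMarkovKernel (leafChannel lam t W k) :=
  Kernel.IsMarkovKernel.map _ (measurable_leafView k)

/-- The data at the subtrees below the root, split into two parts. -/
def splitBranches {A : Type v} {B : Type w} (p : Y × Branches (A × B)) :
    (Y × Branches A) × Branches B :=
  ((p.1, p.2.map Prod.fst), p.2.map Prod.snd)

theorem measurable_splitBranches {A : Type v} {B : Type w} [MeasurableSpace A]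
    [MeasurableSpace B] :
    Measurable (splitBranches : Y × Branches (A × B) → (Y × Branches A) × Branches B) := by
  have h1 := Branches.measurable_map (measurable_fst (α := A) (β := B))
  have h2 := Branches.measurable_map (measurable_snd (α := A) (β := B))
  exact (measurable_fst.prodMk (h1.comp measurable_snd)).prodMk (h2.comp measurable_snd)

theorem treeChannel_map_snd (k : ℕ) :
    (treeChannel lam t (Kernel.id ×ₖ W) k).map (LTree.relabel Prod.snd)
      = treeChannel lam t W k := by
  rw [treeChannel_map lam t _ measurable_snd k, ← Kernel.snd_eq, Kernel.snd_prod]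

/-- Recursion for `leafChannel`: the root of a tree of positive depth contributes its observation
only. -/
theorem leafChannel_succ (k : ℕ) :
    leafChannel lam t W (k + 1)
      = (branchStep lam t W (leafChannel lam t W k)).map splitBranches := by
  have h := branchStep_map lam t (Kernel.id ×ₖ W) (treeChannel lam t (Kernel.id ×ₖ W) k)
    measurable_snd (measurable_leafView k)
  rw [← Kernel.snd_eq, Kernel.snd_prod] at h
  refine Eq.trans ?_ (congrArg (fun κ => κ.map splitBranches) h)
  exact (Kernel.map_comp_right _ (measurable_snd.prodMap
    (Branches.measurable_map (measurable_leafView k))) measurable_splitBranches)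

/-- The survey together with the colours at distance `k + 1` is a degradation of the survey
together with the colours at distance `k`: given the latter, what lies below distance `k` is
independent of the colour of the root. -/
theorem isDegradation_leafChannel_succ (k : ℕ) :
    IsDegradation (leafChannel lam t W (k + 1)) (leafChannel lam t W k) := by
  have hs {k : ℕ} : (leafChannel lam t W (k + 1) : Fin q → Measure _)
      = fun i => (branchStep lam t W (leafChannel lam t W k) i).map splitBranches := by
    funext i
    rw [leafChannel_succ]
    exact Kernel.map_apply _ measurable_splitBranches i
  induction k with
  | zero =>
    rw [hs]
    refine IsDegradation.map (Z' := Y × Branches (LTree Y 0 × LeafLabels (Fin q) 0)) ?_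
      measurable_splitBranches
    -- the colour of the root is part of the output at depth `0`, and the branches are resampled
    -- from it
    let K : Kernel (Fin q) (Branches (LTree Y 0 × LeafLabels (Fin q) 0)) :=
      Kernel.ofFunOfCountable fun i =>
        forest t.offspring ((pottsChannel q lam i).bind (leafChannel lam t W 0))
    have : IsMarkovKernel K := ⟨fun i => by
      have := isProbabilityMeasure_bind_kernel (pottsChannel q lam i) (leafChannel lam t W 0)
      exact forest.instIsProbabilityMeasure _ _⟩
    have h0 (i : Fin q) : leafChannel lam t W 0 i = (W i).prod (Measure.dirac i) := by
      rw [leafChannel, Kernel.map_apply _ (measurable_leafView 0)]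
      change ((Kernel.id ×ₖ W) i).map Prod.swap = _
      rw [Kernel.prod_apply, Kernel.id_apply, Measure.prod_swap]
    have h1 (i : Fin q) : branchStep lam t W (leafChannel lam t W 0) i
        = ((W i).prod (Measure.dirac i)).bind (Kernel.id ∥ₖ K) := by
      rw [← Measure.prod_comp_right, Measure.dirac_bind (Kernel.measurable K)]
      rfl
    have hK : IsMarkovKernel ((Kernel.id : Kernel Y Y) ∥ₖ K) := inferInstance
    refine ⟨(Kernel.id : Kernel Y Y) ∥ₖ K, hK, fun i => ?_⟩
    rw [h1]
    exact congrArg (fun μ => Measure.bind μ ((Kernel.id : Kernel Y Y) ∥ₖ K)) (h0 i).symm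
  | succ k ih =>
    have h1 := (ih.branchStep lam t W).map measurable_splitBranches
    rw [← hs] at h1
    -- the branches of the survey and of the leaves can be zipped back together, so the degradation
    -- at the children descends to the split data
    have h2 := h1.of_map_right (g := fun p : (Y × Branches (LTree Y k)) ×
        Branches (LeafLabels (Fin q) k) => (p.1.1, Branches.zip (p.1.2, p.2)))
      measurable_splitBranches ?_ ?_
    · rw [← hs] at h2
      exact h2
    · exact (measurable_fst.comp measurable_fst).prodMk (Branches.measurable_zip.comp
        ((measurable_snd.comp measurable_fst).prodMk measurable_snd))
    · intro p
      exact Prod.ext rfl (Branches.zip_map p.2)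

end Survey

/-! ### Information about the colour of the root -/

section RootInformation

theorem mutualInfo_map {Ω Ω' α γ : Type*} [MeasurableSpace Ω] [MeasurableSpace Ω']
    [MeasurableSpace α] [MeasurableSpace γ] (P : Measure Ω) {f : Ω → Ω'} (hf : Measurable f)
    {A : Ω' → α} {C : Ω' → γ} (hA : Measurable A) (hC : Measurable C) :
    mutualInfo (P.map f) A C = mutualInfo P (fun x => A (f x)) (fun x => C (f x)) := by
  rw [mutualInfo, Measure.map_map hA hf, Measure.map_map hC hf, Measure.map_map (by fun_prop) hf]
  rfl

variable {q : ℕ} (lam : PottsRange q) (t : TreeKind)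

variable {Y : Type u} [MeasurableSpace Y] (W : Kernel (Fin q) Y) [IsMarkovKernel W]

theorem LTree.root_relabel {α : Type u} {β : Type v} (f : α → β) :
    {k : ℕ} → (s : LTree α k) → (s.relabel f).root = f s.root
  | 0, _ => rfl
  | _ + 1, _ => rfl

theorem measurable_rootColour (k : ℕ) :
    Measurable fun s : LTree (Fin q × Y) k => (s.relabel Prod.fst).root :=
  (LTree.measurable_root k).comp (LTree.measurable_relabel measurable_fst k)

theorem treeChannel_rootColour (k : ℕ) (i : Fin q) :
    ∀ᵐ s ∂(treeChannel lam t (Kernel.id ×ₖ W) k i), (s.relabel Prod.fst).root = i := by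
  have h : ∀ᵐ p ∂((treeChannel lam t (Kernel.id ×ₖ W) k i).map LTree.root), p.1 = i := by
    rw [treeChannel_map_root, Kernel.prod_apply, Kernel.id_apply, Measure.dirac_prod]
    exact (ae_map_iff (by fun_prop) (measurable_fst (measurableSet_singleton i))).2
      (ae_of_all _ fun _ => rfl)
  filter_upwards [ae_of_ae_map (LTree.measurable_root k).aemeasurable h] with s hs
  rw [LTree.root_relabel, hs]

variable [NeZero q]

/-- The mutual information between a uniform input and the output of a channel. -/
def channelInfo {Z : Type*} [MeasurableSpace Z] (M : Kernel (Fin q) Z) : ℝ≥0∞ :=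
  klDiv (uniformColour q ⊗ₘ M) ((uniformColour q).prod ((uniformColour q).bind M))

/-- The law of the tree with every vertex labelled by its colour and its observation. -/
def observedLaw (k : ℕ) : Measure (LTree (Fin q × Y) k) :=
  (uniformColour q).bind (treeChannel lam t (Kernel.id ×ₖ W) k)

instance observedLaw.instIsProbabilityMeasure (k : ℕ) :
    IsProbabilityMeasure (observedLaw lam t W k) :=
  isProbabilityMeasure_bind_kernel _ _

/-- Mutual information with the colour of the root, in terms of the channel from this colour. -/
theorem mutualInfo_observedLaw (k : ℕ) {γ : Type*} [MeasurableSpace γ]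
    {C : LTree (Fin q × Y) k → γ} (hC : Measurable C) :
    mutualInfo (observedLaw lam t W k) (fun s => (s.relabel Prod.fst).root) C
      = channelInfo ((treeChannel lam t (Kernel.id ×ₖ W) k).map C) := by
  have hr := measurable_rootColour (q := q) (Y := Y) k
  have h : (observedLaw lam t W k).map (fun s => ((s.relabel Prod.fst).root, C s))
      = uniformColour q ⊗ₘ (treeChannel lam t (Kernel.id ×ₖ W) k).map C := by
    have := Kernel.IsMarkovKernel.map (treeChannel lam t (Kernel.id ×ₖ W) k) hC
    rw [observedLaw, Measure.map_comp _ _ (hr.prodMk hC), Measure.compProd_eq_comp_prod]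
    congr 1
    ext i : 1
    rw [Kernel.map_apply _ (hr.prodMk hC), Kernel.prod_apply, Kernel.id_apply,
      Measure.dirac_prod, Kernel.map_apply _ hC, Measure.map_map (by fun_prop) hC]
    refine Measure.map_congr ?_
    filter_upwards [treeChannel_rootColour lam t W k i] with s hs
    simp [hs]
  have h1 : (observedLaw lam t W k).map (fun s => (s.relabel Prod.fst).root)
      = uniformColour q := by
    have := Kernel.IsMarkovKernel.map (treeChannel lam t (Kernel.id ×ₖ W) k) hC
    have h2 := congrArg Measure.fst h
    rwa [Measure.fst_map_prodMk hC, Measure.fst_compProd] at h2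
  rw [mutualInfo, h, h1, channelInfo, observedLaw, Measure.map_comp _ _ hC]

theorem surveyLaw_eq_map (k : ℕ) :
    surveyLaw q lam t W k = (observedLaw lam t W k).map
      (fun s => (s.relabel Prod.fst, s.relabel Prod.snd)) := by
  have hm := (LTree.measurable_relabel (measurable_fst (α := Fin q) (β := Y)) k).prodMk
    (LTree.measurable_relabel (measurable_snd (α := Fin q) (β := Y)) k)
  rw [observedLaw, Measure.map_comp _ _ hm, surveyLaw, pottsLaw, Measure.compProd_eq_comp_prod,
    Measure.comp_assoc]
  congr 1
  ext i : 1
  rw [Kernel.map_apply _ hm, treeChannel_prod_map, Kernel.comp_apply,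
    Measure.compProd_eq_comp_prod]

theorem pottsLaw_eq_map (k : ℕ) :
    pottsLaw q lam t k = (observedLaw lam t W k).map (LTree.relabel Prod.fst) := by
  have h := congrArg Measure.fst (surveyLaw_eq_map lam t W k)
  rwa [Measure.fst_map_prodMk (LTree.measurable_relabel measurable_snd k), surveyLaw,
    Measure.fst_compProd] at h

/-- The chain rule for the survey and the colours at distance `k`. The shape of the tree is a
function of the survey, hence does not appear in the channels. -/
theorem channelInfo_add_leafInfoGivenSurvey (k : ℕ) :
    channelInfo (treeChannel lam t W k) + leafInfoGivenSurvey q lam t W k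
      = channelInfo (leafChannel lam t W k) := by
  have hf := LTree.measurable_relabel (measurable_fst (α := Fin q) (β := Y)) k
  have hs := LTree.measurable_relabel (measurable_snd (α := Fin q) (β := Y)) k
  have hr : Measurable (LTree.root ∘ Prod.fst : LTree (Fin q) k × LTree Y k → Fin q) :=
    (LTree.measurable_root k).comp measurable_fst
  have hl : Measurable (LTree.leaves ∘ Prod.fst :
      LTree (Fin q) k × LTree Y k → LeafLabels (Fin q) k) :=
    (LTree.measurable_leaves k).comp measurable_fst
  have hsh : Measurable fun x : LTree (Fin q) k × LTree Y k => (x.1.shape, x.2) :=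
    ((LTree.measurable_shape k).comp measurable_fst).prodMk measurable_snd
  have h := mutualInfo_prodMk_eq_add (surveyLaw q lam t W k) hr hl hsh
  have h1 : mutualInfo (surveyLaw q lam t W k) (LTree.root ∘ Prod.fst)
      (fun x => (x.1.shape, x.2)) = channelInfo (treeChannel lam t W k) := by
    rw [surveyLaw_eq_map, mutualInfo_map _ (hf.prodMk hs) hr hsh, ← treeChannel_map_snd,
      ← mutualInfo_observedLaw lam t W k hs,
      ← mutualInfo_comp_equiv _ (measurable_rootColour k) hs
        (g := fun s => (s.shape, s)) ((LTree.measurable_shape k).prodMk measurable_id)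
        measurable_snd fun _ => rfl]
    simp only [Function.comp_apply, LTree.shape_relabel]
  have h2 : mutualInfo (surveyLaw q lam t W k) (LTree.root ∘ Prod.fst)
      (fun x => ((x.1.shape, x.2), (LTree.leaves ∘ Prod.fst) x))
      = channelInfo (leafChannel lam t W k) := by
    rw [surveyLaw_eq_map, mutualInfo_map _ (hf.prodMk hs) hr (hsh.prodMk hl), leafChannel,
      ← mutualInfo_observedLaw lam t W k (measurable_leafView k),
      ← mutualInfo_comp_equiv _ (measurable_rootColour k) (measurable_leafView k)
        (g := fun p => ((p.1.shape, p.1), p.2))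
        ((((LTree.measurable_shape k).comp measurable_fst).prodMk measurable_fst).prodMk
          measurable_snd)
        (h := fun p => (p.1.2, p.2)) (by fun_prop) fun _ => rfl]
    simp only [Function.comp_apply, leafView, LTree.shape_relabel]
  rw [h1, h2] at h
  exact h.symm

/-- Conditioning on the shape of the tree gives at most the information of the shape together with
the leaves, which are functions of the output of `leafChannel`. -/
theorem leafInfo_le_channelInfo_leafChannel (k : ℕ) :
    leafInfo q lam t k ≤ channelInfo (leafChannel lam t W k) := by
  have h := mutualInfo_prodMk_eq_add (pottsLaw q lam t k) (LTree.measurable_root k)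
    (LTree.measurable_leaves k) (LTree.measurable_shape k)
  refine (le_add_self.trans h.ge).trans ?_
  rw [pottsLaw_eq_map lam t W, mutualInfo_map _ (LTree.measurable_relabel measurable_fst k)
    (LTree.measurable_root k) ((LTree.measurable_shape k).prodMk (LTree.measurable_leaves k)),
    leafChannel, ← mutualInfo_observedLaw lam t W k (measurable_leafView k)]
  have h1 := mutualInfo_comp_le (observedLaw lam t W k) (measurable_rootColour k)
    (measurable_leafView k) (g := fun p => (p.1.shape, p.2))
    (((LTree.measurable_shape k).comp measurable_fst).prodMk measurable_snd)
  simpa only [leafView, LTree.shape_relabel] using h1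

end RootInformation

/-! ### Chi-square bounds for channels -/

section ChiSq

variable {q : ℕ} {Z : Type*} {Z' : Type*} [MeasurableSpace Z] [MeasurableSpace Z']

/-- The `χ²`-information of the channel `M` with respect to a uniform input is at most `s / q`.
The channel is presented by its densities `a x` with respect to a probability measure `ν`; the
condition `∑ x, a x = q` forces `ν` to be the law of the output for a uniform input, and makes
`a x / q` the posterior distribution of the input. -/
def ChiSqBound (M : Fin q → Measure Z) (s : ℝ) : Prop :=
  ∃ (ν : Measure Z) (a : Fin q → Z → ℝ), IsProbabilityMeasure ν ∧ (∀ x, Measurable (a x)) ∧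
    (∀ x z, 0 ≤ a x z) ∧ (∀ z, ∑ x, a x z = q) ∧
    (∀ x, M x = ν.withDensity fun z => ENNReal.ofReal (a x z)) ∧
    (∫⁻ z, ENNReal.ofReal (∑ x, (a x z - 1) ^ 2) ∂ν) ≤ ENNReal.ofReal s

theorem ChiSqBound.mono {M : Fin q → Measure Z} {s s' : ℝ} (h : ChiSqBound M s) (hs : s ≤ s') :
    ChiSqBound M s' := by
  obtain ⟨ν, a, h1, h2, h3, h4, h5, h6⟩ := h
  exact ⟨ν, a, h1, h2, h3, h4, h5, h6.trans (ENNReal.ofReal_le_ofReal hs)⟩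

theorem ChiSqBound.const (ν : Measure Z) [IsProbabilityMeasure ν] :
    ChiSqBound (fun _ : Fin q => ν) 0 :=
  ⟨ν, fun _ _ => 1, inferInstance, fun _ => measurable_const, fun _ _ => zero_le_one,
    fun _ => by simp, fun _ => by simp, by simp⟩

theorem ChiSqBound.map_equiv {M : Fin q → Measure Z} {s : ℝ} (h : ChiSqBound M s)
    (e : Z ≃ᵐ Z') : ChiSqBound (fun x => (M x).map e) s := by
  obtain ⟨ν, a, h1, h2, h3, h4, h5, h6⟩ := h
  refine ⟨ν.map e, fun x z => a x (e.symm z),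
    Measure.isProbabilityMeasure_map e.measurable.aemeasurable,
    fun x => (h2 x).comp e.symm.measurable, fun x z => h3 x _, fun z => h4 _, fun x => ?_, ?_⟩
  · have := h2 x
    refine Measure.ext_of_lintegral _ fun F hF => ?_
    rw [lintegral_map hF e.measurable, h5, lintegral_withDensity_eq_lintegral_mul _ (by fun_prop)
      (by fun_prop), lintegral_withDensity_eq_lintegral_mul _ (by fun_prop) hF,
      lintegral_map (by fun_prop) e.measurable]
    simp
  · rw [lintegral_map_equiv]
    simpa using h6

theorem lintegral_pottsChannel (lam : PottsRange q) (i : Fin q) (F : Fin q → ℝ≥0∞) :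
    ∫⁻ j, F j ∂(pottsChannel q lam i) = ∑ j, ENNReal.ofReal
      ((lam : ℝ) * (if i = j then 1 else 0) + (1 - (lam : ℝ)) / q) * F j := by
  change ∫⁻ j, F j ∂(∑ j : Fin q, ENNReal.ofReal
      ((lam : ℝ) * (if i = j then 1 else 0) + (1 - (lam : ℝ)) / q) • Measure.dirac j) = _
  simp [lintegral_finsetSum_measure, lintegral_smul_measure]

/-- The Potts channel multiplies the deviation of the densities from `1` by `lam`. -/
theorem ChiSqBound.potts (lam : PottsRange q) {M : Kernel (Fin q) Z} {s : ℝ}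
    (h : ChiSqBound M s) :
    ChiSqBound (fun i => (pottsChannel q lam i).bind M) ((lam : ℝ) ^ 2 * s) := by
  obtain ⟨ν, a, h1, h2, h3, h4, h5, h6⟩ := h
  have hw (x : Fin q) (z : Z) : (lam : ℝ) * a x z + (1 - (lam : ℝ)) = ∑ j,
      ((lam : ℝ) * (if x = j then 1 else 0) + (1 - (lam : ℝ)) / q) * a j z := by
    have hq : (q : ℝ) ≠ 0 := by
      have : 0 < q := Nat.zero_lt_of_lt x.isLt
      positivity
    simp only [add_mul, Finset.sum_add_distrib, ← Finset.mul_sum, h4, mul_assoc, ite_mul, one_mul,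
      zero_mul, Finset.sum_ite_eq, Finset.mem_univ, if_true]
    field_simp
  refine ⟨ν, fun x z => (lam : ℝ) * a x z + (1 - (lam : ℝ)), h1, fun x => ?_, fun x z => ?_,
    fun z => ?_, fun x => ?_, ?_⟩
  · exact ((h2 x).const_mul _).add_const _
  · simp only [hw]
    exact Finset.sum_nonneg fun j _ => mul_nonneg (potts_weight_nonneg q lam x j) (h3 j z)
  · rw [Finset.sum_add_distrib, ← Finset.mul_sum, h4]
    simp
    ring
  · ext E hE
    rw [Measure.bind_apply hE (Kernel.measurable M).aemeasurable, lintegral_pottsChannel,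
      withDensity_apply _ hE]
    simp only [hw]
    have : ∀ z, ENNReal.ofReal (∑ j,
        ((lam : ℝ) * (if x = j then 1 else 0) + (1 - (lam : ℝ)) / q) * a j z)
        = ∑ j, ENNReal.ofReal ((lam : ℝ) * (if x = j then 1 else 0) + (1 - (lam : ℝ)) / q) *
          ENNReal.ofReal (a j z) := fun z => by
      rw [ENNReal.ofReal_sum_of_nonneg fun j _ =>
        mul_nonneg (potts_weight_nonneg q lam x j) (h3 j z)]
      exact Finset.sum_congr rfl fun j _ => ENNReal.ofReal_mul (potts_weight_nonneg q lam x j)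
    simp only [this]
    rw [lintegral_finsetSum _ fun j _ => (h2 j).ennreal_ofReal.const_mul _]
    refine Finset.sum_congr rfl fun j _ => ?_
    rw [lintegral_const_mul _ (h2 j).ennreal_ofReal, h5, withDensity_apply _ hE]
  · have (z : Z) : ∑ x, ((lam : ℝ) * a x z + (1 - (lam : ℝ)) - 1) ^ 2
        = (lam : ℝ) ^ 2 * ∑ x, (a x z - 1) ^ 2 := by
      rw [Finset.mul_sum]
      exact Finset.sum_congr rfl fun x _ => by ring
    have hm : Measurable fun z => ENNReal.ofReal (∑ x, (a x z - 1) ^ 2) := by fun_prop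
    simp only [this, ENNReal.ofReal_mul (sq_nonneg (lam : ℝ))]
    rw [lintegral_const_mul _ hm]
    gcongr

/-- A bounded measurable function. -/
def BddMeasurable (f : Z → ℝ) : Prop := Measurable f ∧ ∃ C, ∀ z, |f z| ≤ C

namespace BddMeasurable

variable {f g : Z → ℝ}

theorem const (c : ℝ) : BddMeasurable fun _ : Z => c := ⟨measurable_const, |c|, fun _ => le_rfl⟩

theorem sub (hf : BddMeasurable f) (hg : BddMeasurable g) :
    BddMeasurable fun z => f z - g z := by
  obtain ⟨hf, C, hC⟩ := hf
  obtain ⟨hg, D, hD⟩ := hg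
  exact ⟨hf.sub hg, C + D, fun z => (abs_sub _ _).trans (add_le_add (hC z) (hD z))⟩

theorem mul (hf : BddMeasurable f) (hg : BddMeasurable g) :
    BddMeasurable fun z => f z * g z := by
  obtain ⟨hf, C, hC⟩ := hf
  obtain ⟨hg, D, hD⟩ := hg
  refine ⟨hf.mul hg, C * D, fun z => ?_⟩
  rw [abs_mul]
  exact mul_le_mul (hC z) (hD z) (abs_nonneg _) ((abs_nonneg _).trans (hC z))

theorem sum {f : Fin q → Z → ℝ} (hf : ∀ x, BddMeasurable (f x)) :
    BddMeasurable fun z => ∑ x, f x z := by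
  choose hf C hC using hf
  exact ⟨Finset.measurable_fun_sum _ fun x _ => hf x, ∑ x, C x, fun z =>
    (Finset.abs_sum_le_sum_abs _ _).trans (Finset.sum_le_sum fun x _ => hC x z)⟩

theorem integrable (hf : BddMeasurable f) (ν : Measure Z) [IsFiniteMeasure ν] :
    Integrable f ν := by
  obtain ⟨hf, C, hC⟩ := hf
  exact Integrable.of_bound hf.aestronglyMeasurable C (ae_of_all _ hC)

end BddMeasurable

theorem density_le {a : Fin q → ℝ} (h0 : ∀ x, 0 ≤ a x) (h1 : ∑ x, a x = q) (x : Fin q) :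
    a x ≤ q := by
  rw [← h1]
  exact Finset.single_le_sum (fun y _ => h0 y) (Finset.mem_univ x)

/-- The pointwise inequality behind the bound for pairs. If `m = 1 + r` is the mean of `a * b`, the
left side is `∑ (a * b) ^ 2 / m - q * m`, and `1 / m = 1 - r + r ^ 2 / m`. On the right side the
terms up to third order in the deviations of `a` and `b` are kept: when `a` and `b` are evaluated at
independent points, the mixed ones among them are linear in the deviation of `a` or in that of `b`
and integrate to zero. The rest is estimated by the product of the squared deviations. -/
theorem sum_sq_deviation_mul_le {a b : Fin q → ℝ} (ha0 : ∀ x, 0 ≤ a x) (hb0 : ∀ x, 0 ≤ b x)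
    (ha : ∑ x, a x = q) (hb : ∑ x, b x = q) (hq : 1 ≤ (q : ℝ)) {m : ℝ}
    (hm : q * m = ∑ x, a x * b x) (hm0 : 0 ≤ m) :
    m * ∑ x, (a x * b x / m - 1) ^ 2 ≤
      ∑ x, (a x ^ 2 - 1) + ∑ x, (b x ^ 2 - 1) + ∑ x, (a x ^ 2 - 1) * (b x ^ 2 - 1)
        - (m - 1) * (2 * q + ∑ x, (a x ^ 2 - 1) + ∑ x, (b x ^ 2 - 1))
        + (((q : ℝ) + 1) ^ 2 + q) * ((∑ x, (a x - 1) ^ 2) * ∑ x, (b x - 1) ^ 2) := by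
  set s := m - 1 with hs
  set F := ∑ x, (a x * b x) ^ 2 with hF
  have hms : m = 1 + s := by rw [hs]; ring
  have hFm : F ≤ (q * m) ^ 2 := by
    rw [hm]
    exact Finset.sum_sq_le_sq_sum_of_nonneg fun x _ => mul_nonneg (ha0 x) (hb0 x)
  have hL : m * ∑ x, (a x * b x / m - 1) ^ 2 = F / m - q * m := by
    rcases hm0.eq_or_lt with h0 | hm0
    · simp [← h0]
    have : ∀ x, (a x * b x / m - 1) ^ 2
        = (a x * b x) ^ 2 / m ^ 2 - 2 / m * (a x * b x) + 1 := fun x => by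
      field_simp
      ring
    simp only [this, Finset.sum_add_distrib, Finset.sum_sub_distrib, ← Finset.mul_sum,
      ← Finset.sum_div, ← hm, Finset.sum_const, Finset.card_univ, Fintype.card_fin, nsmul_eq_mul]
    rw [← hF]
    field_simp
    ring
  have hF1 : F / m = F * (1 - s) + F * s ^ 2 / m := by
    rcases hm0.eq_or_lt with h0 | hm0
    · have hF0 : F = 0 := le_antisymm (by simpa [← h0] using hFm)
        (Finset.sum_nonneg fun x _ => sq_nonneg _)
      simp [hF0]
    rw [eq_comm, ← sub_eq_zero]
    field_simp
    rw [hms]; ring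
  have hmq : m ≤ q := by
    have h : q * m ≤ q * q := by
      rw [hm, ← ha, Finset.sum_mul, ha]
      exact Finset.sum_le_sum fun x _ =>
        mul_le_mul_of_nonneg_left (density_le hb0 hb x) (ha0 x)
    exact le_of_mul_le_mul_left h (by linarith)
  have hrem : F * s ^ 2 / m ≤ (q : ℝ) ^ 3 * s ^ 2 := by
    rcases hm0.eq_or_lt with h0 | hm0
    · rw [← h0, div_zero]; positivity
    rw [div_le_iff₀ hm0]
    have h1 : F * s ^ 2 ≤ (q * m) ^ 2 * s ^ 2 := mul_le_mul_of_nonneg_right hFm (sq_nonneg s)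
    have h2 : (q : ℝ) ^ 2 * s ^ 2 * m * m ≤ (q : ℝ) ^ 2 * s ^ 2 * m * q :=
      mul_le_mul_of_nonneg_left hmq (by positivity)
    nlinarith
  set t := ∑ x, |a x - 1| * |b x - 1| with ht
  have ht0 : 0 ≤ t := Finset.sum_nonneg fun x _ => by positivity
  have htAB : t ^ 2 ≤ (∑ x, (a x - 1) ^ 2) * ∑ x, (b x - 1) ^ 2 := by
    have := Finset.sum_mul_sq_le_sq_mul_sq Finset.univ (fun x => |a x - 1|) fun x => |b x - 1|
    simpa only [sq_abs] using this
  have hst : q * |s| ≤ t := by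
    have h : q * s = ∑ x, (a x - 1) * (b x - 1) := by
      have : ∀ x, (a x - 1) * (b x - 1) = a x * b x - a x - b x + 1 := fun x => by ring
      simp only [this, Finset.sum_add_distrib, Finset.sum_sub_distrib, ha, hb, ← hm,
        Finset.sum_const, Finset.card_univ, Fintype.card_fin, nsmul_eq_mul]
      rw [hms]; ring
    have h2 : q * |s| = |q * s| := by rw [abs_mul, abs_of_nonneg (by linarith : (0 : ℝ) ≤ q)]
    rw [h2, h]
    refine (Finset.abs_sum_le_sum_abs _ _).trans (le_of_eq ?_)
    exact Finset.sum_congr rfl fun x _ => abs_mul _ _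
  have hab : |∑ x, (a x ^ 2 - 1) * (b x ^ 2 - 1)| ≤ ((q : ℝ) + 1) ^ 2 * t := by
    refine (Finset.abs_sum_le_sum_abs _ _).trans ?_
    rw [ht, Finset.mul_sum]
    refine Finset.sum_le_sum fun x _ => ?_
    have e : (a x ^ 2 - 1) * (b x ^ 2 - 1)
        = ((a x + 1) * (b x + 1)) * ((a x - 1) * (b x - 1)) := by ring
    rw [e, abs_mul, abs_mul (a x - 1)]
    refine mul_le_mul_of_nonneg_right ?_ (by positivity)
    have h1 := density_le ha0 ha x
    have h2 := density_le hb0 hb x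
    rw [abs_of_nonneg (mul_nonneg (by linarith [ha0 x]) (by linarith [hb0 x])), sq]
    exact mul_le_mul (by linarith) (by linarith) (by linarith [hb0 x]) (by linarith)
  have h3 : -(s * ∑ x, (a x ^ 2 - 1) * (b x ^ 2 - 1)) ≤ ((q : ℝ) + 1) ^ 2 * t ^ 2 := by
    have h1 : |s| ≤ t := le_trans (le_mul_of_one_le_left (abs_nonneg s) hq) hst
    calc -(s * ∑ x, (a x ^ 2 - 1) * (b x ^ 2 - 1))
        ≤ |s| * |∑ x, (a x ^ 2 - 1) * (b x ^ 2 - 1)| := by rw [← abs_mul]; exact neg_le_abs _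
      _ ≤ t * (((q : ℝ) + 1) ^ 2 * t) := mul_le_mul h1 hab (abs_nonneg _) ht0
      _ = _ := by ring
  have h4 : (q : ℝ) ^ 3 * s ^ 2 ≤ q * t ^ 2 := by
    have h5 : (q * |s|) ^ 2 ≤ t ^ 2 := pow_le_pow_left₀ (by positivity) hst 2
    rw [mul_pow, sq_abs] at h5
    calc (q : ℝ) ^ 3 * s ^ 2 = q * (q ^ 2 * s ^ 2) := by ring
      _ ≤ q * t ^ 2 := mul_le_mul_of_nonneg_left h5 (by linarith)
  have hFe : F = q + ∑ x, (a x ^ 2 - 1) + ∑ x, (b x ^ 2 - 1)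
      + ∑ x, (a x ^ 2 - 1) * (b x ^ 2 - 1) := by
    have hc : (q : ℝ) = ∑ _x : Fin q, (1 : ℝ) := by simp
    rw [hF]
    conv_rhs => rw [hc]
    rw [← Finset.sum_add_distrib, ← Finset.sum_add_distrib, ← Finset.sum_add_distrib]
    exact Finset.sum_congr rfl fun x _ => by ring
  have h6 : (((q : ℝ) + 1) ^ 2 + q) * t ^ 2
      ≤ (((q : ℝ) + 1) ^ 2 + q) * ((∑ x, (a x - 1) ^ 2) * ∑ x, (b x - 1) ^ 2) :=
    mul_le_mul_of_nonneg_left htAB (by positivity)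
  rw [hL, hF1, hms]
  have h7 : F * (1 - s) - q * (1 + s) = ∑ x, (a x ^ 2 - 1) + ∑ x, (b x ^ 2 - 1)
      + ∑ x, (a x ^ 2 - 1) * (b x ^ 2 - 1)
      - s * (2 * q + ∑ x, (a x ^ 2 - 1) + ∑ x, (b x ^ 2 - 1))
      - s * ∑ x, (a x ^ 2 - 1) * (b x ^ 2 - 1) := by rw [hFe]; ring
  rw [hms] at hrem
  linarith

end ChiSq

/-! ### The chi-square bound of a pair of observations -/

section ChiSqProd

variable {q : ℕ} {Z : Type*} {Z' : Type*} [MeasurableSpace Z] [MeasurableSpace Z']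

/-- The constant in front of the product of two `χ²`-bounds in the bound for a pair of
observations. -/
def chiSqConst (q : ℕ) : ℝ := ((q : ℝ) + 1) ^ 2 + q + 1

theorem chiSqConst_pos (q : ℕ) : 0 < chiSqConst q := by unfold chiSqConst; positivity

theorem bddMeasurable_density {a : Fin q → Z → ℝ} (hm : ∀ x, Measurable (a x))
    (h0 : ∀ x z, 0 ≤ a x z) (h1 : ∀ z, ∑ x, a x z = q) (x : Fin q) : BddMeasurable (a x) :=
  ⟨hm x, q, fun z => by
    rw [abs_of_nonneg (h0 x z)]; exact density_le (fun x => h0 x z) (h1 z) x⟩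

theorem integral_density_sub_one {ν : Measure Z} [IsProbabilityMeasure ν] {a : Z → ℝ}
    (ha : BddMeasurable a) (h0 : ∀ z, 0 ≤ a z)
    [hp : IsProbabilityMeasure (ν.withDensity fun z => ENNReal.ofReal (a z))] :
    ∫ z, (a z - 1) ∂ν = 0 := by
  have h : ∫⁻ z, ENNReal.ofReal (a z) ∂ν = 1 := by
    rw [← setLIntegral_univ, ← withDensity_apply _ MeasurableSet.univ]
    exact measure_univ
  have h2 : ∫ z, a z ∂ν = 1 := by
    rw [integral_eq_lintegral_of_nonneg_ae (ae_of_all _ h0) ha.1.aestronglyMeasurable, h]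
    simp
  rw [integral_sub (ha.integrable ν) (integrable_const _), h2]
  simp

theorem integral_sq_sub_one {ν : Measure Z} [IsProbabilityMeasure ν] {a : Z → ℝ}
    (ha : BddMeasurable a) (h : ∫ z, (a z - 1) ∂ν = 0) :
    ∫ z, (a z ^ 2 - 1) ∂ν = ∫ z, (a z - 1) ^ 2 ∂ν := by
  have h1 : ∀ z, a z ^ 2 - 1 = (a z - 1) ^ 2 + 2 * (a z - 1) := fun z => by ring
  have hs := ha.sub (.const 1)
  simp only [h1]
  rw [integral_add, integral_const_mul, h, mul_zero, add_zero]
  · simpa only [sq] using (hs.mul hs).integrable ν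
  · exact (hs.integrable ν).const_mul 2

/-- The integral of the upper bound of `sum_sq_deviation_mul_le`. -/
theorem integral_deviation_bound {μ : Measure Z} {ν : Measure Z'} [IsProbabilityMeasure μ]
    [IsProbabilityMeasure ν] {a : Fin q → Z → ℝ} {b : Fin q → Z' → ℝ}
    (ha : ∀ x, BddMeasurable (a x)) (hb : ∀ x, BddMeasurable (b x))
    (ha1 : ∀ x, ∫ z, (a x z - 1) ∂μ = 0) (hb1 : ∀ x, ∫ z, (b x z - 1) ∂ν = 0) (c : ℝ)
    (I J : Fin q → ℝ) (hI : ∀ x, ∫ z, (a x z - 1) ^ 2 ∂μ = I x)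
    (hJ : ∀ x, ∫ z, (b x z - 1) ^ 2 ∂ν = J x) :
    let G : Z × Z' → ℝ := fun p => ∑ x, (a x p.1 ^ 2 - 1) + ∑ x, (b x p.2 ^ 2 - 1)
        + ∑ x, (a x p.1 ^ 2 - 1) * (b x p.2 ^ 2 - 1)
        - ∑ x, (2 * ((a x p.1 - 1) * (b x p.2 - 1))
          + ((a x p.1 - 1) * ∑ y, (a y p.1 ^ 2 - 1)) * (b x p.2 - 1) / q
          + (a x p.1 - 1) * ((b x p.2 - 1) * ∑ y, (b y p.2 ^ 2 - 1)) / q)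
        + c * ((∑ x, (a x p.1 - 1) ^ 2) * ∑ x, (b x p.2 - 1) ^ 2)
    Integrable G (μ.prod ν) ∧
      ∫ p, G p ∂(μ.prod ν) = ∑ x, I x + ∑ x, J x + ∑ x, I x * J x
        + c * ((∑ x, I x) * ∑ x, J x) := by
  intro G
  have hA x := (ha x).sub (.const 1)
  have hB x := (hb x).sub (.const 1)
  have hAs x : BddMeasurable fun z => (a x z - 1) ^ 2 := by
    simpa only [sq] using (hA x).mul (hA x)
  have hBs x : BddMeasurable fun z => (b x z - 1) ^ 2 := by
    simpa only [sq] using (hB x).mul (hB x)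
  have hα x : BddMeasurable fun z => a x z ^ 2 - 1 := by
    simpa only [sq] using ((ha x).mul (ha x)).sub (.const 1)
  have hβ x : BddMeasurable fun z => b x z ^ 2 - 1 := by
    simpa only [sq] using ((hb x).mul (hb x)).sub (.const 1)
  have hIα x : ∫ z, (a x z ^ 2 - 1) ∂μ = I x := (integral_sq_sub_one (ha x) (ha1 x)).trans (hI x)
  have hJβ x : ∫ z, (b x z ^ 2 - 1) ∂ν = J x := (integral_sq_sub_one (hb x) (hb1 x)).trans (hJ x)
  have hP {u : Z → ℝ} {v : Z' → ℝ} (hu : BddMeasurable u) (hv : BddMeasurable v) :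
      Integrable (fun p : Z × Z' => u p.1 * v p.2) (μ.prod ν) :=
    (hu.integrable μ).mul_prod (hv.integrable ν)
  have i1 : Integrable (fun p : Z × Z' => ∑ x, (a x p.1 ^ 2 - 1)) (μ.prod ν) :=
    (BddMeasurable.sum hα).integrable μ |>.comp_fst ν
  have i2 : Integrable (fun p : Z × Z' => ∑ x, (b x p.2 ^ 2 - 1)) (μ.prod ν) :=
    (BddMeasurable.sum hβ).integrable ν |>.comp_snd μ
  have i3 : Integrable (fun p : Z × Z' => ∑ x, (a x p.1 ^ 2 - 1) * (b x p.2 ^ 2 - 1))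
      (μ.prod ν) := integrable_finsetSum _ fun x _ => hP (hα x) (hβ x)
  have j1 x : Integrable (fun p : Z × Z' => 2 * ((a x p.1 - 1) * (b x p.2 - 1))) (μ.prod ν) :=
    (hP (hA x) (hB x)).const_mul 2
  have j2 x : Integrable (fun p : Z × Z' =>
      ((a x p.1 - 1) * ∑ y, (a y p.1 ^ 2 - 1)) * (b x p.2 - 1) / q) (μ.prod ν) :=
    (hP ((hA x).mul (.sum hα)) (hB x)).div_const _
  have j3 x : Integrable (fun p : Z × Z' =>
      (a x p.1 - 1) * ((b x p.2 - 1) * ∑ y, (b y p.2 ^ 2 - 1)) / q) (μ.prod ν) :=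
    (hP (hA x) ((hB x).mul (.sum hβ))).div_const _
  have i4 : Integrable (fun p : Z × Z' => ∑ x, (2 * ((a x p.1 - 1) * (b x p.2 - 1))
          + ((a x p.1 - 1) * ∑ y, (a y p.1 ^ 2 - 1)) * (b x p.2 - 1) / q
          + (a x p.1 - 1) * ((b x p.2 - 1) * ∑ y, (b y p.2 ^ 2 - 1)) / q)) (μ.prod ν) :=
    integrable_finsetSum _ fun x _ => ((j1 x).add (j2 x)).add (j3 x)
  have i5 : Integrable (fun p : Z × Z' =>
      c * ((∑ x, (a x p.1 - 1) ^ 2) * ∑ x, (b x p.2 - 1) ^ 2)) (μ.prod ν) :=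
    (hP (.sum hAs) (.sum hBs)).const_mul c
  refine ⟨(((i1.add i2).add i3).sub i4).add i5, ?_⟩
  have k1 : ∫ p, ∑ x, (a x p.1 ^ 2 - 1) ∂(μ.prod ν) = ∑ x, I x := by
    rw [integral_fun_fst (f := fun z => ∑ x, (a x z ^ 2 - 1)),
      integral_finsetSum _ fun x _ => (hα x).integrable μ]
    simp [hIα]
  have k2 : ∫ p, ∑ x, (b x p.2 ^ 2 - 1) ∂(μ.prod ν) = ∑ x, J x := by
    rw [integral_fun_snd (f := fun z => ∑ x, (b x z ^ 2 - 1)),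
      integral_finsetSum _ fun x _ => (hβ x).integrable ν]
    simp [hJβ]
  have k3 : ∫ p, ∑ x, (a x p.1 ^ 2 - 1) * (b x p.2 ^ 2 - 1) ∂(μ.prod ν) = ∑ x, I x * J x := by
    rw [integral_finsetSum _ fun x _ => hP (hα x) (hβ x)]
    refine Finset.sum_congr rfl fun x _ => ?_
    rw [integral_prod_mul (fun z => a x z ^ 2 - 1) (fun z => b x z ^ 2 - 1), hIα, hJβ]
  have k4 : ∫ p, ∑ x, (2 * ((a x p.1 - 1) * (b x p.2 - 1))
          + ((a x p.1 - 1) * ∑ y, (a y p.1 ^ 2 - 1)) * (b x p.2 - 1) / q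
          + (a x p.1 - 1) * ((b x p.2 - 1) * ∑ y, (b y p.2 ^ 2 - 1)) / q) ∂(μ.prod ν) = 0 := by
    have e0 := integral_finsetSum (μ := μ.prod ν) Finset.univ
      fun x _ => ((j1 x).add (j2 x)).add (j3 x)
    simp only [Pi.add_apply] at e0
    rw [e0]
    refine Finset.sum_eq_zero fun x _ => ?_
    have e1 := integral_add ((j1 x).add (j2 x)) (j3 x)
    simp only [Pi.add_apply] at e1
    rw [e1, integral_add (j1 x) (j2 x), integral_const_mul,
      integral_div, integral_div,
      integral_prod_mul (fun z => a x z - 1) (fun z => b x z - 1),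
      integral_prod_mul (fun z => (a x z - 1) * ∑ y, (a y z ^ 2 - 1)) (fun z => b x z - 1),
      integral_prod_mul (fun z => a x z - 1) (fun z => (b x z - 1) * ∑ y, (b y z ^ 2 - 1)),
      ha1, hb1]
    simp
  have k5 : ∫ p, c * ((∑ x, (a x p.1 - 1) ^ 2) * ∑ x, (b x p.2 - 1) ^ 2) ∂(μ.prod ν)
      = c * ((∑ x, I x) * ∑ x, J x) := by
    rw [integral_const_mul, integral_prod_mul (fun z => ∑ x, (a x z - 1) ^ 2)
      (fun z => ∑ x, (b x z - 1) ^ 2), integral_finsetSum _ fun x _ => (hAs x).integrable μ,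
      integral_finsetSum _ fun x _ => (hBs x).integrable ν]
    simp only [hI, hJ]
  have e1 := integral_add (((i1.add i2).add i3).sub i4) i5
  have e2 := integral_sub ((i1.add i2).add i3) i4
  have e3 := integral_add (i1.add i2) i3
  simp only [Pi.add_apply, Pi.sub_apply] at e1 e2 e3
  rw [e1, e2, e3, integral_add i1 i2, k1, k2, k3, k4, k5, sub_zero]

theorem integral_sum_sq_le {ν : Measure Z} [IsProbabilityMeasure ν] {a : Fin q → Z → ℝ}
    (ha : ∀ x, BddMeasurable (a x)) {s : ℝ} (hs : 0 ≤ s)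
    (h : ∫⁻ z, ENNReal.ofReal (∑ x, (a x z - 1) ^ 2) ∂ν ≤ ENNReal.ofReal s) :
    ∑ x, ∫ z, (a x z - 1) ^ 2 ∂ν ≤ s := by
  have hA x : BddMeasurable fun z => (a x z - 1) ^ 2 := by
    simpa only [sq] using ((ha x).sub (.const 1)).mul ((ha x).sub (.const 1))
  rw [← integral_finsetSum _ fun x _ => (hA x).integrable ν]
  rw [← ofReal_integral_eq_lintegral_ofReal ((BddMeasurable.sum hA).integrable ν)
    (ae_of_all _ fun z => Finset.sum_nonneg fun x _ => sq_nonneg _)] at h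
  exact (ENNReal.ofReal_le_ofReal_iff hs).1 h

/-- The `χ²`-bounds of two conditionally independent observations add up, up to an error which is
proportional to their product. -/
theorem ChiSqBound.prod {M : Fin q → Measure Z} {N : Fin q → Measure Z'}
    [hM : ∀ x, IsProbabilityMeasure (M x)] [hN : ∀ x, IsProbabilityMeasure (N x)] {s s' : ℝ}
    (hq : 0 < q) (hs : 0 ≤ s) (hs' : 0 ≤ s') (h : ChiSqBound M s) (h' : ChiSqBound N s') :
    ChiSqBound (fun x => (M x).prod (N x)) (s + s' + chiSqConst q * (s * s')) := by
  obtain ⟨μ, a, hμ, ha, ha0, hasum, hMa, hsa⟩ := h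
  obtain ⟨ν, b, hν, hb, hb0, hbsum, hNb, hsb⟩ := h'
  have hq1 : (1 : ℝ) ≤ q := by exact_mod_cast hq
  have hq0 : (q : ℝ) ≠ 0 := by positivity
  set m : Z × Z' → ℝ := fun p => (∑ x, a x p.1 * b x p.2) / q with hmdef
  have hqm p : q * m p = ∑ x, a x p.1 * b x p.2 := by
    simp only [hmdef]; field_simp
  have hm0 p : 0 ≤ m p :=
    div_nonneg (Finset.sum_nonneg fun x _ => mul_nonneg (ha0 _ _) (hb0 _ _)) (by positivity)
  have hmm : Measurable m := by fun_prop
  have hmz p (hp : m p = 0) x : a x p.1 * b x p.2 = 0 := by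
    have h := hqm p
    rw [hp, mul_zero, eq_comm, Finset.sum_eq_zero_iff_of_nonneg
      fun x _ => mul_nonneg (ha0 x _) (hb0 x _)] at h
    exact h x (Finset.mem_univ x)
  have hprod x : (M x).prod (N x)
      = (μ.prod ν).withDensity fun p => ENNReal.ofReal (a x p.1 * b x p.2) := by
    have := ha x
    have := hb x
    rw [hMa, hNb, prod_withDensity (by fun_prop) (by fun_prop)]
    simp only [ENNReal.ofReal_mul (ha0 _ _)]
  -- the density of the pair with respect to its output law, which has density `m` with respect
  -- to `μ.prod ν`; the value `1` on the null set where `m` vanishes keeps the sum equal to `q`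
  set g : Fin q → Z × Z' → ℝ := fun x p =>
    if m p = 0 then 1 else a x p.1 * b x p.2 / m p with hg
  have hgm x : Measurable (g x) :=
    Measurable.ite (measurableSet_eq_fun hmm measurable_const) measurable_const (by fun_prop)
  refine ⟨(μ.prod ν).withDensity fun p => ENNReal.ofReal (m p), g, ⟨?_⟩, hgm, fun x p => ?_,
    fun p => ?_, fun x => ?_, ?_⟩
  · have h1 p : ENNReal.ofReal (m p)
        = ENNReal.ofReal (q : ℝ)⁻¹ * ∑ x, ENNReal.ofReal (a x p.1 * b x p.2) := by
      rw [← ENNReal.ofReal_sum_of_nonneg fun x _ => mul_nonneg (ha0 x _) (hb0 x _),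
        ← ENNReal.ofReal_mul (by positivity), hmdef]
      congr 1
      ring
    rw [withDensity_apply _ MeasurableSet.univ, setLIntegral_univ]
    simp only [h1]
    rw [lintegral_const_mul _ (by fun_prop), lintegral_finsetSum _ fun x _ => by fun_prop]
    have h2 x : ∫⁻ p, ENNReal.ofReal (a x p.1 * b x p.2) ∂(μ.prod ν) = 1 := by
      rw [← setLIntegral_univ, ← withDensity_apply _ MeasurableSet.univ, ← hprod]
      exact measure_univ
    simp only [h2, Finset.sum_const, Finset.card_univ, Fintype.card_fin, nsmul_eq_mul, mul_one]
    rw [← ENNReal.ofReal_natCast, ← ENNReal.ofReal_mul (by positivity), inv_mul_cancel₀ hq0,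
      ENNReal.ofReal_one]
  · simp only [hg]
    split_ifs
    · exact zero_le_one
    · exact div_nonneg (mul_nonneg (ha0 _ _) (hb0 _ _)) (hm0 p)
  · simp only [hg]
    split_ifs with h0
    · simp
    · rw [← Finset.sum_div, ← hqm, mul_div_cancel_right₀ _ h0]
  · have := hgm x
    refine (hprod x).trans ?_
    rw [← withDensity_mul _ (by fun_prop) (by fun_prop)]
    congr 1
    funext p
    rw [Pi.mul_apply, ← ENNReal.ofReal_mul (hm0 p)]
    congr 1
    simp only [hg]
    split_ifs with h0
    -- where `m` vanishes so do all the densities `a x * b x`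
    · rw [hmz p h0, h0, zero_mul]
    · rw [mul_div_cancel₀ _ h0]
  · have hab x := bddMeasurable_density ha ha0 hasum x
    have hbb x := bddMeasurable_density hb hb0 hbsum x
    have ha1 x : ∫ z, (a x z - 1) ∂μ = 0 :=
      have : IsProbabilityMeasure (μ.withDensity fun z => ENNReal.ofReal (a x z)) :=
        hMa x ▸ hM x
      integral_density_sub_one (hab x) (ha0 x)
    have hb1 x : ∫ z, (b x z - 1) ∂ν = 0 :=
      have : IsProbabilityMeasure (ν.withDensity fun z => ENNReal.ofReal (b x z)) :=
        hNb x ▸ hN x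
      integral_density_sub_one (hbb x) (hb0 x)
    have hG := integral_deviation_bound hab hbb ha1 hb1 (((q : ℝ) + 1) ^ 2 + q) _ _
      (fun _ => rfl) (fun _ => rfl)
    set G : Z × Z' → ℝ := fun p => ∑ x, (a x p.1 ^ 2 - 1) + ∑ x, (b x p.2 ^ 2 - 1)
        + ∑ x, (a x p.1 ^ 2 - 1) * (b x p.2 ^ 2 - 1)
        - ∑ x, (2 * ((a x p.1 - 1) * (b x p.2 - 1))
          + ((a x p.1 - 1) * ∑ y, (a y p.1 ^ 2 - 1)) * (b x p.2 - 1) / q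
          + (a x p.1 - 1) * ((b x p.2 - 1) * ∑ y, (b y p.2 ^ 2 - 1)) / q)
        + (((q : ℝ) + 1) ^ 2 + q) * ((∑ x, (a x p.1 - 1) ^ 2) * ∑ x, (b x p.2 - 1) ^ 2) with hGdef
    obtain ⟨hGi, hGv⟩ := hG
    have hpt p : m p * ∑ x, (g x p - 1) ^ 2 ≤ G p := by
      have h1 := sum_sq_deviation_mul_le (fun x => ha0 x p.1) (fun x => hb0 x p.2)
        (hasum p.1) (hbsum p.2) hq1 (hqm p) (hm0 p)
      have h2 : m p * ∑ x, (g x p - 1) ^ 2 = m p * ∑ x, (a x p.1 * b x p.2 / m p - 1) ^ 2 := by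
        by_cases h0 : m p = 0
        · simp [h0]
        · simp only [hg, if_neg h0]
      have h3 : m p - 1 = (∑ x, (a x p.1 - 1) * (b x p.2 - 1)) / q := by
        have : ∀ x, (a x p.1 - 1) * (b x p.2 - 1)
            = a x p.1 * b x p.2 - a x p.1 - b x p.2 + 1 := fun x => by ring
        simp only [this, Finset.sum_add_distrib, Finset.sum_sub_distrib, hasum, hbsum, ← hqm,
          Finset.sum_const, Finset.card_univ, Fintype.card_fin, nsmul_eq_mul]
        field_simp
        ring
      rw [h2]
      refine h1.trans (le_of_eq ?_)
      simp only [hGdef]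
      congr 2
      rw [h3, Finset.sum_div, Finset.sum_mul]
      refine Finset.sum_congr rfl fun x _ => ?_
      field_simp
    have hG0 p : 0 ≤ G p :=
      (mul_nonneg (hm0 p) (Finset.sum_nonneg fun x _ => sq_nonneg _)).trans (hpt p)
    rw [lintegral_withDensity_eq_lintegral_mul _ (by fun_prop) (by fun_prop)]
    calc ∫⁻ p, ((fun p => ENNReal.ofReal (m p)) *
            fun p => ENNReal.ofReal (∑ x, (g x p - 1) ^ 2)) p ∂(μ.prod ν)
        ≤ ∫⁻ p, ENNReal.ofReal (G p) ∂(μ.prod ν) := by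
          refine lintegral_mono fun p => ?_
          rw [Pi.mul_apply, ← ENNReal.ofReal_mul (hm0 p)]
          exact ENNReal.ofReal_le_ofReal (hpt p)
      _ = ENNReal.ofReal (∫ p, G p ∂(μ.prod ν)) :=
          (ofReal_integral_eq_lintegral_ofReal hGi (ae_of_all _ hG0)).symm
      _ ≤ _ := ?_
    refine ENNReal.ofReal_le_ofReal ?_
    rw [hGv]
    have hI := integral_sum_sq_le hab hs hsa
    have hJ := integral_sum_sq_le hbb hs' hsb
    have hI0 x : 0 ≤ ∫ z, (a x z - 1) ^ 2 ∂μ := integral_nonneg fun z => sq_nonneg _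
    have hJ0 x : 0 ≤ ∫ z, (b x z - 1) ^ 2 ∂ν := integral_nonneg fun z => sq_nonneg _
    have hIJ : (∑ x, ∫ z, (a x z - 1) ^ 2 ∂μ) * ∑ x, ∫ z, (b x z - 1) ^ 2 ∂ν ≤ s * s' :=
      mul_le_mul hI hJ (Finset.sum_nonneg fun x _ => hJ0 x) hs
    have hIJ' : ∑ x, (∫ z, (a x z - 1) ^ 2 ∂μ) * ∫ z, (b x z - 1) ^ 2 ∂ν ≤ s * s' := by
      refine le_trans ?_ hIJ
      rw [Finset.sum_mul]
      exact Finset.sum_le_sum fun x _ => mul_le_mul_of_nonneg_left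
        (Finset.single_le_sum (fun y _ => hJ0 y) (Finset.mem_univ x)) (hI0 x)
    have hc := mul_le_mul_of_nonneg_left hIJ (by positivity : 0 ≤ ((q : ℝ) + 1) ^ 2 + q)
    unfold chiSqConst
    linarith

end ChiSqProd

/-! ### The chi-square bound of tree channels -/

section ChiSqForest

variable {q : ℕ} {Z : Type*} [MeasurableSpace Z]

/-- Iterating `ChiSqBound.prod`: `1 + chiSqConst q * s` is multiplicative. -/
theorem ChiSqBound.pi {M : Fin q → Measure Z} [hM : ∀ x, IsProbabilityMeasure (M x)] {s : ℝ}
    (hq : 0 < q) (hs : 0 ≤ s) (h : ChiSqBound M s) (b : ℕ) :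
    ChiSqBound (fun x => Measure.pi fun _ : Fin b => M x)
      (((1 + chiSqConst q * s) ^ b - 1) / chiSqConst q) := by
  have hK := chiSqConst_pos q
  induction b with
  | zero =>
    have h0 (x : Fin q) : (Measure.pi fun _ : Fin 0 => M x) = Measure.dirac isEmptyElim :=
      Measure.pi_of_empty _ _
    simp only [h0, pow_zero, sub_self, zero_div]
    exact ChiSqBound.const _
  | succ b ih =>
    have h1 : 0 ≤ ((1 + chiSqConst q * s) ^ b - 1) / chiSqConst q :=
      div_nonneg (sub_nonneg.2 (one_le_pow₀ (le_add_of_nonneg_right (by positivity)))) hK.le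
    have h2 := (h.prod hq hs h1 ih).map_equiv
      (MeasurableEquiv.piFinSuccAbove (fun _ : Fin (b + 1) => Z) 0).symm
    have h3 (x : Fin q) : ((M x).prod (Measure.pi fun _ : Fin b => M x)).map
        (MeasurableEquiv.piFinSuccAbove (fun _ : Fin (b + 1) => Z) 0).symm
        = Measure.pi fun _ : Fin (b + 1) => M x :=
      (measurePreserving_piFinSuccAbove (fun _ : Fin (b + 1) => M x) 0).symm.map_eq
    simp only [h3] at h2
    convert h2 using 1
    field_simp
    ring

/-- The number of subtrees is part of the output and independent of the input, so the bounds of the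
forests of given size are averaged. -/
theorem ChiSqBound.forest {Z : Type u} [MeasurableSpace Z] {M : Fin q → Measure Z}
    [hM : ∀ x, IsProbabilityMeasure (M x)] {s s' : ℝ} (hq : 0 < q) (hs : 0 ≤ s)
    (h : ChiSqBound M s) (D : Measure ℕ) [IsProbabilityMeasure D]
    (hD : ∫⁻ b, ENNReal.ofReal (((1 + chiSqConst q * s) ^ b - 1) / chiSqConst q) ∂D
      ≤ ENNReal.ofReal s') :
    ChiSqBound (fun x => _root_.forest D (M x)) s' := by
  choose ν a hν ha ha0 hasum hMa hsa using fun b => h.pi hq hs b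
  have hR {F : Branches Z → ℝ≥0∞} (hF : Measurable F) :
      ∫⁻ t, F t ∂(D.bind fun b => (ν b).map (Branches.mk b))
        = ∫⁻ b, ∫⁻ f, F (Branches.mk b f) ∂(ν b) ∂D := by
    rw [Measure.lintegral_bind (measurable_of_countable _).aemeasurable hF.aemeasurable]
    exact lintegral_congr fun b => lintegral_map hF (Branches.measurable_mk b)
  have ham x : Measurable fun t : Branches Z => a t.1 x t.2 :=
    Branches.measurable_of_mk fun b => ha b x
  -- for each size `b` the `b`-tuples have their own reference law `ν b` and densities `a b`
  refine ⟨D.bind fun b => (ν b).map (Branches.mk b), fun x t => a t.1 x t.2,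
    isProbabilityMeasure_bind_sigma D ν, ham, fun x t => ha0 _ _ _, fun t => hasum _ _,
    fun x => ?_, ?_⟩
  · have := ham x
    refine Measure.ext_of_lintegral _ fun F hF => ?_
    rw [lintegral_forest _ _ hF, lintegral_withDensity_eq_lintegral_mul _ (by fun_prop) hF,
      hR (by fun_prop)]
    refine lintegral_congr fun b => ?_
    have := ha b x
    have hMa' : (Measure.pi fun _ : Fin b => M x)
        = (ν b).withDensity fun z => ENNReal.ofReal (a b x z) := hMa b x
    rw [hMa', lintegral_withDensity_eq_lintegral_mul _ (by fun_prop)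
      (by exact hF.comp (Branches.measurable_mk b))]
    rfl
  · rw [hR (by fun_prop)]
    exact (lintegral_mono fun b => hsa b).trans hD

/-- The generating function of the offspring law is at most that of the Poisson law of the same
mean. -/
theorem lintegral_offspring_le (t : TreeKind) {K x : ℝ} (hK : 0 < K) (hx : 0 ≤ x) :
    ∫⁻ b, ENNReal.ofReal (((1 + x) ^ b - 1) / K) ∂t.offspring
      ≤ ENNReal.ofReal ((Real.exp (t.degree * x) - 1) / K) := by
  cases t with
  | regular d =>
    simp only [TreeKind.offspring, TreeKind.degree, lintegral_dirac]
    refine ENNReal.ofReal_le_ofReal ?_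
    rw [Real.exp_nat_mul]
    have h := pow_le_pow_left₀ (by positivity) (Real.add_one_le_exp x) d
    rw [add_comm x 1] at h
    gcongr
  | poisson d =>
    simp only [TreeKind.offspring, TreeKind.degree, poissonMeasure, lintegral_sum_measure,
      lintegral_smul_measure, lintegral_dirac, smul_eq_mul]
    have h1 (n : ℕ) : 0 ≤ ((1 + x) ^ n - 1) / K :=
      div_nonneg (sub_nonneg.2 (one_le_pow₀ (by linarith))) hK.le
    have h2 (n : ℕ) : 0 ≤ Real.exp (-d) * (d : ℝ) ^ n / n.factorial := by positivity
    have h3 : HasSum (fun n : ℕ => Real.exp (-d) * (d : ℝ) ^ n / n.factorial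
        * (((1 + x) ^ n - 1) / K)) ((Real.exp (d * x) - 1) / K) := by
      have e1 := (NormedSpace.expSeries_div_hasSum_exp ((d : ℝ) * (1 + x))).mul_left
        (Real.exp (-d))
      have e2 := (e1.sub (hasSum_one_poissonMeasure d)).div_const K
      rw [← Real.exp_eq_exp_ℝ, ← Real.exp_add] at e2
      have hf : (fun n : ℕ => Real.exp (-d) * (d : ℝ) ^ n / n.factorial
          * (((1 + x) ^ n - 1) / K)) = fun n : ℕ =>
            (Real.exp (-d) * ((d * (1 + x)) ^ n / n.factorial)
              - Real.exp (-d) * (d : ℝ) ^ n / n.factorial) / K := by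
        funext n
        rw [mul_pow]
        ring
      have hv : (d : ℝ) * x = -d + d * (1 + x) := by ring
      rw [hf, hv]
      exact e2
    rw [← h3.tsum_eq, ENNReal.ofReal_tsum_of_nonneg (fun n => mul_nonneg (h2 n) (h1 n)) h3.summable]
    refine ENNReal.tsum_le_tsum fun n => ?_
    rw [ENNReal.ofReal_mul (h2 n)]

/-- One step of the recursion for the `χ²`-bound. -/
theorem ChiSqBound.branchStep {X : Type u} [MeasurableSpace X] {Z : Type v} [MeasurableSpace Z]
    (hq : 0 < q) (lam : PottsRange q) (t : TreeKind) {V : Kernel (Fin q) X} [IsMarkovKernel V]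
    {M : Kernel (Fin q) Z} [IsMarkovKernel M] {s₀ s : ℝ} (hs₀ : 0 ≤ s₀) (hs : 0 ≤ s)
    (hV : ChiSqBound V s₀) (hM : ChiSqBound M s)
    (h : (1 + chiSqConst q * s₀) * Real.exp (t.degree * (lam : ℝ) ^ 2 * (chiSqConst q * s))
      ≤ 1 + chiSqConst q * s) :
    ChiSqBound (branchStep lam t V M) s := by
  have hK := chiSqConst_pos q
  have : ∀ i, IsProbabilityMeasure ((pottsChannel q lam i).bind M) :=
    fun i => isProbabilityMeasure_bind_kernel _ _
  have hd : 0 ≤ t.degree := by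
    cases t with
    | regular d => exact Nat.cast_nonneg d
    | poisson d => exact d.2
  have h1 := (hM.potts lam).forest hq (by positivity) t.offspring
    (lintegral_offspring_le t hK (by positivity))
  have h2 : 0 ≤ (Real.exp (t.degree * (chiSqConst q * ((lam : ℝ) ^ 2 * s))) - 1)
      / chiSqConst q :=
    div_nonneg (sub_nonneg.2 (Real.one_le_exp (by positivity))) hK.le
  refine (hV.prod hq hs₀ h2 h1).mono ?_
  have e : t.degree * (lam : ℝ) ^ 2 * (chiSqConst q * s)
      = t.degree * (chiSqConst q * ((lam : ℝ) ^ 2 * s)) := by ring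
  rw [e] at h
  refine le_of_mul_le_mul_left ?_ hK
  set E := Real.exp (t.degree * (chiSqConst q * ((lam : ℝ) ^ 2 * s)))
  have hE : chiSqConst q * (s₀ + (E - 1) / chiSqConst q
      + chiSqConst q * (s₀ * ((E - 1) / chiSqConst q)))
      = (1 + chiSqConst q * s₀) * E - 1 := by
    field_simp
    ring
  linarith

/-- A bound that is invariant under the recursion holds at all depths. -/
theorem ChiSqBound.treeChannel {X : Type u} [MeasurableSpace X]
    (hq : 0 < q) (lam : PottsRange q) (t : TreeKind) {V : Kernel (Fin q) X} [IsMarkovKernel V]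
    {s₀ s : ℝ} (hs₀ : 0 ≤ s₀) (hs : s₀ ≤ s) (hV : ChiSqBound V s₀)
    (h : (1 + chiSqConst q * s₀) * Real.exp (t.degree * (lam : ℝ) ^ 2 * (chiSqConst q * s))
      ≤ 1 + chiSqConst q * s) : (k : ℕ) → ChiSqBound (treeChannel lam t V k) s
  | 0 => hV.mono hs
  | k + 1 => ChiSqBound.branchStep hq lam t hs₀ (hs₀.trans hs) hV
      (ChiSqBound.treeChannel hq lam t hs₀ hs hV h k) h

end ChiSqForest

/-! ### Chi-square bounds and mutual information -/

section ChiSqInformation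

variable {q : ℕ} [NeZero q] {Z : Type*} [MeasurableSpace Z]

theorem uniformColour_singleton (x : Fin q) :
    uniformColour q {x} = (q : ℝ≥0∞)⁻¹ := by
  rw [uniformColour, PMF.toMeasure_apply_singleton _ _ (measurableSet_singleton x)]
  simp

theorem lintegral_uniformColour (F : Fin q → ℝ≥0∞) :
    ∫⁻ x, F x ∂(uniformColour q) = (q : ℝ≥0∞)⁻¹ * ∑ x, F x := by
  rw [lintegral_fintype, Finset.mul_sum]
  exact Finset.sum_congr rfl fun x _ => by rw [uniformColour_singleton, mul_comm]

/-- The mutual information is at most the `χ²`-information. -/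
theorem ChiSqBound.channelInfo_le {M : Kernel (Fin q) Z} [IsMarkovKernel M] {s : ℝ}
    (h : ChiSqBound M s) : channelInfo M ≤ ENNReal.ofReal s := by
  obtain ⟨ν, a, hν, ha, ha0, hasum, hMa, hsa⟩ := h
  have hq : (q : ℝ≥0∞) ≠ 0 := by simp [NeZero.ne q]
  have hsum z : (q : ℝ≥0∞)⁻¹ * ∑ x, ENNReal.ofReal (a x z) = 1 := by
    rw [← ENNReal.ofReal_sum_of_nonneg fun x _ => ha0 x z, hasum, ENNReal.ofReal_natCast,
      ENNReal.inv_mul_cancel hq (ENNReal.natCast_ne_top q)]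
  have hout : (uniformColour q).bind M = ν := by
    refine Measure.ext_of_lintegral _ fun F hF => ?_
    rw [Measure.lintegral_bind (Kernel.measurable M).aemeasurable hF.aemeasurable,
      lintegral_uniformColour]
    have h1 x : ∫⁻ z, F z ∂(M x) = ∫⁻ z, ENNReal.ofReal (a x z) * F z ∂ν := by
      have := ha x
      rw [hMa, lintegral_withDensity_eq_lintegral_mul _ (by fun_prop) hF]
      rfl
    simp only [h1]
    rw [← lintegral_finsetSum _ fun x _ => by have := ha x; fun_prop,
      ← lintegral_const_mul _ (by fun_prop)]
    refine lintegral_congr fun z => ?_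
    rw [← Finset.sum_mul, ← mul_assoc, hsum, one_mul]
  have ham : Measurable fun p : Fin q × Z => a p.1 p.2 :=
    measurable_from_prod_countable_right fun x => ha x
  have hjoint : uniformColour q ⊗ₘ M
      = ((uniformColour q).prod ν).withDensity fun p => ENNReal.ofReal (a p.1 p.2) := by
    refine Measure.ext_of_lintegral _ fun F hF => ?_
    rw [Measure.lintegral_compProd hF, lintegral_withDensity_eq_lintegral_mul _ (by fun_prop) hF,
      lintegral_prod _ (by fun_prop)]
    refine lintegral_congr fun x => ?_
    have := ha x
    rw [hMa, lintegral_withDensity_eq_lintegral_mul _ (by fun_prop) (by fun_prop)]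
    rfl
  rw [channelInfo, hout, klDiv_eq_lintegral_klFun_of_ac
    (by rw [hjoint]; exact withDensity_absolutelyContinuous _ _)]
  have hrn : (uniformColour q ⊗ₘ M).rnDeriv ((uniformColour q).prod ν)
      =ᵐ[(uniformColour q).prod ν] fun p => ENNReal.ofReal (a p.1 p.2) := by
    rw [hjoint]
    exact Measure.rnDeriv_withDensity _ (by fun_prop)
  -- `x log x + 1 - x ≤ (x - 1) ^ 2`, since `log x ≤ x - 1`
  have hkl (x : ℝ) (hx : 0 ≤ x) : klFun x ≤ (x - 1) ^ 2 := by
    rw [klFun_apply]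
    rcases hx.eq_or_lt with h0 | h0
    · simp [← h0]
    · nlinarith [mul_le_mul_of_nonneg_left (Real.log_le_sub_one_of_pos h0) hx]
  calc ∫⁻ p, ENNReal.ofReal (klFun ((uniformColour q ⊗ₘ M).rnDeriv
          ((uniformColour q).prod ν) p).toReal) ∂((uniformColour q).prod ν)
      ≤ ∫⁻ p, ENNReal.ofReal ((a p.1 p.2 - 1) ^ 2) ∂((uniformColour q).prod ν) := by
        refine lintegral_mono_ae ?_
        filter_upwards [hrn] with p hp
        rw [hp, ENNReal.toReal_ofReal (ha0 _ _)]
        exact ENNReal.ofReal_le_ofReal (hkl _ (ha0 _ _))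
    _ = ∫⁻ z, (q : ℝ≥0∞)⁻¹ * ENNReal.ofReal (∑ x, (a x z - 1) ^ 2) ∂ν := by
        rw [lintegral_prod_symm _ (by fun_prop)]
        refine lintegral_congr fun z => ?_
        rw [lintegral_uniformColour, ENNReal.ofReal_sum_of_nonneg fun x _ => sq_nonneg _]
    _ ≤ ∫⁻ z, ENNReal.ofReal (∑ x, (a x z - 1) ^ 2) ∂ν := by
        refine lintegral_mono fun z => mul_le_of_le_one_left zero_le ?_
        rw [ENNReal.inv_le_one]
        exact_mod_cast NeZero.one_le
    _ ≤ _ := hsa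

/-- The densities provided by the posterior distribution realize the `χ²`-capacity. -/
theorem chiSqBound_chiSqCapacity (W : Kernel (Fin q) Z) [IsMarkovKernel W] :
    ChiSqBound W (q * chiSqCapacity W) := by
  have hq0 : (q : ℝ) ≠ 0 := by exact_mod_cast NeZero.ne q
  have hq : (q : ℝ≥0∞) ≠ 0 := by simp [NeZero.ne q]
  set ν := (uniformColour q).bind W with hν
  have hνp : IsProbabilityMeasure ν := isProbabilityMeasure_bind_kernel _ _
  set π := posterior W (uniformColour q) with hπ
  have hm x : Measurable fun y => (π y).real {x} :=
    (Kernel.measurable_coe π (measurableSet_singleton x)).ennreal_toReal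
  have hsum y : ∑ x, (π y).real {x} = 1 := by
    have h := measureReal_biUnion_finset (μ := π y) (s := Finset.univ) (f := fun x : Fin q => {x})
      (fun x _ y _ hxy => Set.disjoint_singleton.2 hxy) fun x _ => measurableSet_singleton x
    rw [← h]
    have : (⋃ x ∈ (Finset.univ : Finset (Fin q)), ({x} : Set (Fin q))) = Set.univ := by
      ext; simp
    rw [this, probReal_univ]
  have hle y x : (π y).real {x} ≤ 1 := measureReal_le_one
  have hsq y : ∑ x, (q * (π y).real {x} - 1) ^ 2
      = q * (q * ∑ x, (π y).real {x} ^ 2 - 1) := by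
    have : ∀ x, (q * (π y).real {x} - 1) ^ 2
        = q * (q * (π y).real {x} ^ 2) - 2 * q * (π y).real {x} + 1 := fun x => by ring
    simp only [this, Finset.sum_add_distrib, Finset.sum_sub_distrib, ← Finset.mul_sum, hsum]
    simp
    ring
  refine ⟨ν, fun x y => q * (π y).real {x}, hνp, fun x => (hm x).const_mul _,
    fun x y => by positivity, fun y => by rw [← Finset.mul_sum, hsum, mul_one], fun x => ?_, ?_⟩
  · ext E hE
    have h1 : (ν ⊗ₘ π) (E ×ˢ {x}) = (uniformColour q ⊗ₘ W) ({x} ×ˢ E) := by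
      rw [hν, hπ, compProd_posterior_eq_map_swap, Measure.map_apply measurable_swap
        (hE.prod (measurableSet_singleton x)), Set.preimage_swap_prod]
    rw [Measure.compProd_apply_prod hE (measurableSet_singleton x),
      Measure.compProd_apply_prod (measurableSet_singleton x) hE, lintegral_singleton,
      uniformColour_singleton] at h1
    rw [withDensity_apply _ hE]
    have h2 y : ENNReal.ofReal (q * (π y).real {x}) = q * π y {x} := by
      rw [ENNReal.ofReal_mul (by positivity), ENNReal.ofReal_natCast, ofReal_measureReal]
    simp only [h2]
    rw [lintegral_const_mul _ (Kernel.measurable_coe π (measurableSet_singleton x)), h1,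
      mul_comm (W x E), ← mul_assoc, ENNReal.mul_inv_cancel hq (ENNReal.natCast_ne_top q), one_mul]
  · rw [← ofReal_integral_eq_lintegral_ofReal]
    · refine ENNReal.ofReal_le_ofReal (le_of_eq ?_)
      simp only [hsq]
      rw [integral_const_mul]
      rfl
    · refine BddMeasurable.integrable (.sum fun x => ?_) ν
      have : BddMeasurable fun y => q * (π y).real {x} :=
        (BddMeasurable.const (q : ℝ)).mul ⟨hm x, 1, fun y => by
          rw [abs_of_nonneg measureReal_nonneg]; exact hle y x⟩
      simpa only [sq] using (this.sub (.const 1)).mul (this.sub (.const 1))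
    · exact ae_of_all _ fun y => Finset.sum_nonneg fun x _ => sq_nonneg _

end ChiSqInformation

/-! ### Survey information below the Kesten-Stigum threshold -/

/-- Below the Kesten-Stigum threshold a small interval is invariant under the recursion for the
`χ²`-bound, if the bound for a single observation is small. -/
theorem exists_invariant_bound {K r η : ℝ} (hK : 0 < K) (hr0 : 0 ≤ r) (hr : r < 1) (hη : 0 < η) :
    ∃ s₀ s : ℝ, 0 < s₀ ∧ s₀ ≤ s ∧ s ≤ η ∧
      (1 + K * s₀) * Real.exp (r * (K * s)) ≤ 1 + K * s := by
  set s := min η ((1 - r) / (2 * K)) with hs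
  have hs0 : 0 < s := lt_min hη (div_pos (by linarith) (by positivity))
  have hKs : K * s ≤ (1 - r) / 2 := by
    have := mul_le_mul_of_nonneg_left (min_le_right η ((1 - r) / (2 * K))) hK.le
    rw [← hs] at this
    refine this.trans (le_of_eq ?_)
    field_simp
  have hKs0 : 0 < K * s := by positivity
  have hexp : Real.exp (r * (K * s)) < 1 + K * s := by
    have h1 := Real.add_one_le_exp (-(r * (K * s)))
    rw [Real.exp_neg] at h1
    have h2 : 0 < Real.exp (r * (K * s)) := Real.exp_pos _
    have h3 : (1 - r * (K * s)) * Real.exp (r * (K * s)) ≤ 1 := by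
      calc _ ≤ (Real.exp (r * (K * s)))⁻¹ * Real.exp (r * (K * s)) :=
            mul_le_mul_of_nonneg_right (by linarith) h2.le
        _ = 1 := inv_mul_cancel₀ h2.ne'
    have h4 : r * (K * s) ≤ K * s := mul_le_of_le_one_left hKs0.le hr.le
    have h5 : 1 < (1 - r * (K * s)) * (1 + K * s) := by nlinarith
    exact lt_of_mul_lt_mul_left (h3.trans_lt h5) (by linarith)
  -- the value of `s₀` for which equality holds in the invariance condition
  set s₁ := ((1 + K * s) / Real.exp (r * (K * s)) - 1) / K with hs₁
  have hs₁0 : 0 < s₁ :=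
    div_pos (sub_pos.2 ((one_lt_div (Real.exp_pos _)).2 hexp)) hK
  refine ⟨min s s₁, s, lt_min hs0 hs₁0, min_le_left _ _, min_le_left _ _, ?_⟩
  calc (1 + K * min s s₁) * Real.exp (r * (K * s))
      ≤ (1 + K * s₁) * Real.exp (r * (K * s)) := by
        have := min_le_right s s₁
        gcongr
    _ = 1 + K * s := by
        rw [hs₁]
        have := (Real.exp_pos (r * (K * s))).ne'
        field_simp
        ring

/-- The information provided by the colours at distance `k` given the survey is nonincreasing
in `k`. -/
theorem antitone_leafInfoGivenSurvey {q : ℕ} [NeZero q] (lam : PottsRange q) (t : TreeKind)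
    {Y : Type u} [MeasurableSpace Y] (W : Kernel (Fin q) Y) [IsMarkovKernel W]
    (hfin : ∀ k, channelInfo (treeChannel lam t W k) ≠ ⊤) :
    Antitone (leafInfoGivenSurvey q lam t W) := by
  refine antitone_nat_of_succ_le fun k => ?_
  refine ENNReal.le_of_add_le_add_left (hfin k) ?_
  rw [channelInfo_add_leafInfoGivenSurvey]
  refine le_trans ?_ ((isDegradation_leafChannel_succ lam t W k).klDiv_compProd_le
    (uniformColour q))
  change _ ≤ channelInfo (leafChannel lam t W (k + 1))
  rw [← channelInfo_add_leafInfoGivenSurvey]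
  exact add_le_add_left ((isDegradation_treeChannel_succ lam t W k).klDiv_compProd_le
    (uniformColour q)) _

theorem theorem2 (q : ℕ) [q.AtLeastTwo] (lam : PottsRange q) (t : TreeKind)
    (hKS : t.degree * (lam : ℝ) ^ 2 < 1) (hrec : AdmitsReconstruction q lam t) :
    ∃ ε : ℝ, 0 < ε ∧
      ∀ (Y : Type u) [MeasurableSpace Y] (W : Kernel (Fin q) Y) [IsMarkovKernel W],
        IsFMS W → chiSqCapacity W ≤ ε →
          ∃ l : ℝ≥0∞, 0 < l ∧ Tendsto (leafInfoGivenSurvey q lam t W) atTop (𝓝 l) := by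
  obtain ⟨l₀, hl₀, hlim⟩ := hrec
  -- the survey is to carry less information than `η < l₀`
  obtain ⟨η, hη0, hη⟩ := ENNReal.lt_iff_exists_nnreal_btwn.1 hl₀
  have hq : 0 < q := NeZero.pos q
  have hd : 0 ≤ t.degree := by
    cases t with
    | regular d => exact Nat.cast_nonneg d
    | poisson d => exact d.2
  obtain ⟨s₀, s, hs₀, hs, hsη, hinv⟩ := exists_invariant_bound (chiSqConst_pos q)
    (r := t.degree * (lam : ℝ) ^ 2) (η := η) (by positivity) hKS (by exact_mod_cast hη0)
  refine ⟨s₀ / q, by positivity, fun Y _ W _ _ hW => ?_⟩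
  have hbound := ChiSqBound.treeChannel hq lam t hs₀.le hs
    ((chiSqBound_chiSqCapacity W).mono (by rwa [le_div_iff₀' (by positivity)] at hW)) hinv
  have hinfo (k : ℕ) : channelInfo (treeChannel lam t W k) ≤ η :=
    ((hbound k).channelInfo_le.trans (ENNReal.ofReal_le_ofReal hsη)).trans_eq
      (ENNReal.ofReal_coe_nnreal)
  have hanti := antitone_leafInfoGivenSurvey lam t W
    fun k => ne_top_of_le_ne_top ENNReal.coe_ne_top (hinfo k)
  refine ⟨⨅ k, leafInfoGivenSurvey q lam t W k, ?_, tendsto_atTop_iInf hanti⟩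
  have hle : l₀ ≤ η + ⨅ k, leafInfoGivenSurvey q lam t W k := by
    refine le_of_tendsto_of_tendsto' hlim ((tendsto_atTop_iInf hanti).const_add _) fun k => ?_
    refine (leafInfo_le_channelInfo_leafChannel lam t W k).trans ?_
    rw [← channelInfo_add_leafInfoGivenSurvey]
    exact add_le_add_left (hinfo k) _
  refine pos_iff_ne_zero.2 fun h0 => ?_
  rw [h0, add_zero] at hle
  exact absurd hη (not_lt.2 hle)

end
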